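/- **Lemma (orthogonal projection).** Let $(\Omega,\mathcal F,\mathbb P)$ be a probability space with a filtration $(\mathcal F_\tau)$, and let $w$ be a $d$-dimensional Brownian motion on $[0,1]$ with respect to $(\mathcal F_\tau)$ (adapted, $w_0=0$ a.s., a.s. continuous, $w_t-w_s\sim\mathcal N(0,(t-s)I_d)$ and independent of $\mathcal F_s$ for $0\le s\le t\le 1$). Let $0=\tau_0<\dots<\tau_N=1$, fix $k\in\{0,\dots,N-1\}$, and write $\Delta\tau_k=\tau_{k+1}-\tau_k$, $\Delta w_k=w_{\tau_{k+1}}-w_{\tau_k}$, $\mathbb E_k[\cdot]=\mathbb E[\cdot\mid\mathcal F_{\tau_k}]$. Let $H_k(\tau)$, $\tau\in[\tau_k,\tau_{k+1}]$, be a random $n\times d$ matrix, jointly measurable in $(\tau,\omega)$ for the product of the Borel $\sigma$-algebra and $\mathcal F_{\tau_k}$, with $\int_{\tau_k}^{\tau_{k+1}}\|H_k(\tau)\|_F^2\,d\tau<\infty$ a.s. Then the Itô integral $\int_{\tau_k}^{\tau_{k+1}}H_k(\tau)\,dw_\tau$ exists, and, conditionally on $\mathcal F_{\tau_k}$, the time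 average $$\bar H_k=\frac1{\Delta\tau_k}\int_{\tau_k}^{\tau_{k+1}}H_k(\tau)\,d\tau$$ is the unique minimizer over $G\in\mathbb R^{n\times d}$ of the conditional mean-square error $$J(G)=\mathbb E_k\Big[\Big\|\int_{\tau_k}^{\tau_{k+1}}H_k(\tau)\,dw_\tau-G\,\Delta w_k\Big\|^2\Big].$$ Precisely: $\bar H_k$ is $\mathcal F_{\tau_k}$-measurable and $J(\bar H_k)<\infty$ a.s.; for every $\mathcal F_{\tau_k}$-measurable matrix $G$ (in particular every deterministic one), a.s. $J(\bar H_k)\le J(G)$, with strict inequality wherever $G\ne\bar H_k$; and there is a version of $(\omega,G)\mapsto J(G)(\omega)$, continuous in $G$ and agreeing a.s. with $J(G)$ for every $\mathcal F_{\tau_k}$-measurable $G$, for which, outside a single null set, $J(\bar H_k(\omega))(\omega)<J(G)(\omega)$ for all matrices $G\ne\bar H_k(\omega)$ simultaneously. In particular, all this holds for the frozen diffusion integrand of the linearized dynamics, whose $i$-th column is $$H_{k,i}(\tau)=\Phi(\tau_{k+1},\tau)\big(\tilde A^{(i)}_\tau x_k+\tilde F^{(i)}_\tau\tilde u_k+\tilde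 d^{(i)}_\tau\big),\qquad i=1,\dots,d,$$ where $x_k\in\mathbb R^n$ and $\tilde u_k\in\mathbb R^{m+1}$ are $\mathcal F_{\tau_k}$-measurable, the deterministic coefficients $\tilde A^{(i)},\tilde F^{(i)},\tilde d^{(i)}$ are measurable and bounded on $[\tau_k,\tau_{k+1}]$, and $\Phi$ is the state transition matrix of $\dot z=A_\tau z$ with $A$ bounded: $\Phi(s,s)=I$ and, for each $s\in[\tau_k,\tau_{k+1}]$, $\Phi(\cdot,s)$ is continuous on $[\tau_k,\tau_{k+1}]$ with $\partial_\tau\Phi(\tau,s)=A_\tau\Phi(\tau,s)$ on $[\tau_k,\tau_{k+1})$. -/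

import Mathlib

open MeasureTheory ProbabilityTheory Filter Topology
open scoped ENNReal

noncomputable section

/-- `w` is a `d`-dimensional Brownian motion on the time interval `[0, T]` with respect to the
filtration `F`. Only the times in `[0, T]` matter. -/
structure IsBrownianMotionOn {Ω : Type*} {mΩ : MeasurableSpace Ω} {d : ℕ} (P : Measure Ω)
    (F : Filtration ℝ mΩ) (T : ℝ) (w : ℝ → Ω → EuclideanSpace ℝ (Fin d)) : Prop where
  adapted : ∀ t ∈ Set.Icc 0 T, Measurable[F t] (w t)
  zero : ∀ᵐ ω ∂P, w 0 ω = 0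
  indep : ∀ s t, 0 ≤ s → s ≤ t → t ≤ T →
    Indep (MeasurableSpace.comap (fun ω => w t ω - w s ω) inferInstance) (F s) P
  law : ∀ s t, 0 ≤ s → s ≤ t → t ≤ T →
    HasLaw (fun ω => w t ω - w s ω)
      (multivariateGaussian 0 ((t - s) • (1 : Matrix (Fin d) (Fin d) ℝ))) P
  cont : ∀ᵐ ω ∂P, ContinuousOn (fun t => w t ω) (Set.Icc 0 T)

/-- The squared Frobenius norm of a matrix. -/
def frobeniusSq {n d : ℕ} (M : Matrix (Fin n) (Fin d) ℝ) : ℝ := ∑ p, ∑ q, M p q ^ 2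

/-- A matrix-valued adapted step process on `(a, b]`:
it is equal to `ξ i` on `(t i, t (i + 1)]` for `i < N`, and `ξ i` is `F (t i)`-measurable. -/
structure StepProcess {Ω : Type*} {mΩ : MeasurableSpace Ω} (F : Filtration ℝ mΩ) (n d : ℕ)
    (a b : ℝ) where
  N : ℕ
  t : ℕ → ℝ
  mono : Monotone t
  t_zero : t 0 = a
  t_last : t N = b
  ξ : ℕ → Ω → Matrix (Fin n) (Fin d) ℝ
  meas : ∀ i p q, Measurable[F (t i)] (fun ω => ξ i ω p q)

namespace StepProcess

variable {Ω : Type*} {mΩ : MeasurableSpace Ω} {F : Filtration ℝ mΩ} {n d : ℕ} {a b : ℝ}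

/-- The value at time `s` of a step process. -/
def value (S : StepProcess F n d a b) (s : ℝ) (ω : Ω) : Matrix (Fin n) (Fin d) ℝ :=
  ∑ i ∈ Finset.range S.N, (Set.Ioc (S.t i) (S.t (i + 1))).indicator (fun _ => S.ξ i ω) s

/-- The elementary stochastic integral `∑ i, ξ i (w (t (i + 1)) - w (t i))` of a step process. -/
def integral (S : StepProcess F n d a b) (w : ℝ → Ω → EuclideanSpace ℝ (Fin d)) (ω : Ω) :
    EuclideanSpace ℝ (Fin n) :=
  ∑ i ∈ Finset.range S.N,
    Matrix.toEuclideanLin (S.ξ i ω) (w (S.t (i + 1)) ω - w (S.t i) ω)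

end StepProcess

/-- `I` is (a version of) the Itô integral over `[a, b]` of the matrix-valued process `H` with
respect to `w`: there are adapted step processes `S m` such that `∫ ‖S m - H‖_F² ds` over `[a, b]`
tends to `0` in probability and the elementary integrals of `S m` tend to `I` in probability. -/
def IsItoIntegral {Ω : Type*} {mΩ : MeasurableSpace Ω} {n d : ℕ} (P : Measure Ω)
    (F : Filtration ℝ mΩ) (w : ℝ → Ω → EuclideanSpace ℝ (Fin d)) (a b : ℝ)
    (H : ℝ → Ω → Matrix (Fin n) (Fin d) ℝ) (I : Ω → EuclideanSpace ℝ (Fin n)) : Prop :=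
  ∃ S : ℕ → StepProcess F n d a b,
    (∀ ε : ℝ≥0∞, 0 < ε → Tendsto
      (fun m => P {ω | ε ≤ ∫⁻ s in Set.Ioc a b,
        ENNReal.ofReal (frobeniusSq ((S m).value s ω - H s ω))}) atTop (𝓝 0)) ∧
    TendstoInMeasure P (fun m => (S m).integral w) atTop I

open Classical in
/-- The Itô integral `∫ H dw` over `[a, b]`, chosen among its versions
(and `0` if there is none). -/
def itoIntegral {Ω : Type*} {mΩ : MeasurableSpace Ω} {n d : ℕ} (P : Measure Ω)
    (F : Filtration ℝ mΩ) (w : ℝ → Ω → EuclideanSpace ℝ (Fin d)) (a b : ℝ)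
    (H : ℝ → Ω → Matrix (Fin n) (Fin d) ℝ) : Ω → EuclideanSpace ℝ (Fin n) :=
  if h : ∃ I, IsItoIntegral P F w a b H I then h.choose else 0

/-- The time average `(b - a)⁻¹ ∫ H dτ` of `H` over `[a, b]`. -/
def timeAverage {Ω : Type*} {n d : ℕ} (a b : ℝ) (H : ℝ → Ω → Matrix (Fin n) (Fin d) ℝ) (ω : Ω) :
    Matrix (Fin n) (Fin d) ℝ :=
  Matrix.of fun p q => (1 / (b - a)) * ∫ τ in a..b, H τ ω p q

/-- The conditional mean-square error `E[‖∫ H dw - G (w b - w a)‖² | F a]`, as a random variable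
with values in `[0, ∞]`. The matrix `G` may depend on the outcome. -/
def condMSE {Ω : Type*} {mΩ : MeasurableSpace Ω} {n d : ℕ} (P : Measure Ω)
    (F : Filtration ℝ mΩ) (w : ℝ → Ω → EuclideanSpace ℝ (Fin d)) (a b : ℝ)
    (H : ℝ → Ω → Matrix (Fin n) (Fin d) ℝ) (G : Ω → Matrix (Fin n) (Fin d) ℝ) : Ω → ℝ≥0∞ :=
  condLExp (F a) P fun ω =>
    ‖itoIntegral P F w a b H ω - Matrix.toEuclideanLin (G ω) (w b ω - w a ω)‖ₑ ^ 2

/-- A random matrix is measurable with respect to the σ-algebra `m`, that is, it is constant once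
one conditions on `m`. -/
def MatrixMeasurable {Ω : Type*} {n d : ℕ} (m : MeasurableSpace Ω)
    (G : Ω → Matrix (Fin n) (Fin d) ℝ) : Prop :=
  ∀ p q, Measurable[m] fun ω => G ω p q

/-- Conditionally on `F a`, the matrix `K` is the unique minimizer of the conditional mean-square
error. This is said in both usual ways: against every `F a`-measurable matrix `G` (in particular
every deterministic one), outcome by outcome; and, outside one null set, against all matrices at
once, for the version `J ω G` of the conditional mean-square error that is continuous in `G`. -/
structure UniquelyMinimizesCondMSE {Ω : Type*} {mΩ : MeasurableSpace Ω} {n d : ℕ} (P : Measure Ω)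
    (F : Filtration ℝ mΩ) (w : ℝ → Ω → EuclideanSpace ℝ (Fin d)) (a b : ℝ)
    (H : ℝ → Ω → Matrix (Fin n) (Fin d) ℝ) (K : Ω → Matrix (Fin n) (Fin d) ℝ) : Prop where
  measurable : MatrixMeasurable (F a) K
  finite : ∀ᵐ ω ∂P, condMSE P F w a b H K ω < ∞
  le_and_lt : ∀ G, MatrixMeasurable (F a) G → ∀ᵐ ω ∂P,
    condMSE P F w a b H K ω ≤ condMSE P F w a b H G ω ∧
    (G ω ≠ K ω → condMSE P F w a b H K ω < condMSE P F w a b H G ω)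
  simultaneous : ∃ J : Ω → Matrix (Fin n) (Fin d) ℝ → ℝ≥0∞,
    (∀ ω, Continuous (J ω)) ∧
    (∀ G, MatrixMeasurable (F a) G → ∀ᵐ ω ∂P, condMSE P F w a b H G ω = J ω (G ω)) ∧
    ∀ᵐ ω ∂P, ∀ G, G ≠ K ω → J ω (K ω) < J ω G

/-- `Φ` is the state transition matrix of `ż = A z` on `[a, b]`. At the right endpoint, where `A`
may jump, continuity is asked for. -/
structure IsStateTransitionOn {n : ℕ} (A : ℝ → Matrix (Fin n) (Fin n) ℝ) (a b : ℝ)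
    (Φ : ℝ → ℝ → Matrix (Fin n) (Fin n) ℝ) : Prop where
  self : ∀ s ∈ Set.Icc a b, Φ s s = 1
  cont : ∀ s ∈ Set.Icc a b, ∀ p q, ContinuousOn (fun τ => Φ τ s p q) (Set.Icc a b)
  deriv : ∀ s ∈ Set.Icc a b, ∀ τ ∈ Set.Ico a b, ∀ p q,
    HasDerivWithinAt (fun r => Φ r s p q) ((A τ * Φ τ s) p q) (Set.Icc a b) τ

/-- A matrix-valued function of time is bounded on `[a, b]`. -/
def BoundedOn {n l : ℕ} (M : ℝ → Matrix (Fin n) (Fin l) ℝ) (a b : ℝ) : Prop :=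
  ∃ C : ℝ, ∀ τ ∈ Set.Icc a b, ∀ p q, |M τ p q| ≤ C

/-- The frozen diffusion integrand: its `i`-th column at time `τ` is
`Φ(b, τ) (At i τ x + Ft i τ u + dt i τ)`. -/
def frozenIntegrand {Ω : Type*} {n m d : ℕ} (Φ : ℝ → ℝ → Matrix (Fin n) (Fin n) ℝ)
    (At : Fin d → ℝ → Matrix (Fin n) (Fin n) ℝ) (Ft : Fin d → ℝ → Matrix (Fin n) (Fin (m + 1)) ℝ)
    (dt : Fin d → ℝ → Fin n → ℝ) (b : ℝ) (x : Ω → Fin n → ℝ) (u : Ω → Fin (m + 1) → ℝ)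
    (τ : ℝ) (ω : Ω) : Matrix (Fin n) (Fin d) ℝ :=
  Matrix.of fun p i =>
    (Φ b τ).mulVec ((At i τ).mulVec (x ω) + (Ft i τ).mulVec (u ω) + dt i τ) p

end

theorem frobeniusSq_nonneg {n d : ℕ} (M : Matrix (Fin n) (Fin d) ℝ) : 0 ≤ frobeniusSq M :=
  Finset.sum_nonneg fun _ _ => Finset.sum_nonneg fun _ _ => sq_nonneg _

@[simp]
theorem frobeniusSq_zero {n d : ℕ} : frobeniusSq (0 : Matrix (Fin n) (Fin d) ℝ) = 0 := by
  simp [frobeniusSq]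

theorem frobeniusSq_smul {n d : ℕ} (c : ℝ) (M : Matrix (Fin n) (Fin d) ℝ) :
    frobeniusSq (c • M) = c ^ 2 * frobeniusSq M := by
  simp [frobeniusSq, Finset.mul_sum, mul_pow]

theorem frobeniusSq_neg {n d : ℕ} (M : Matrix (Fin n) (Fin d) ℝ) :
    frobeniusSq (-M) = frobeniusSq M := by
  simp [frobeniusSq]

theorem frobeniusSq_add_le {n d : ℕ} (M M' : Matrix (Fin n) (Fin d) ℝ) :
    frobeniusSq (M + M') ≤ 2 * frobeniusSq M + 2 * frobeniusSq M' := by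
  simp only [frobeniusSq, Finset.mul_sum, ← Finset.sum_add_distrib, Matrix.add_apply]
  gcongr with p _ q _
  nlinarith [sq_nonneg (M p q - M' p q)]

theorem frobeniusSq_pos {n d : ℕ} {M : Matrix (Fin n) (Fin d) ℝ} (hM : M ≠ 0) :
    0 < frobeniusSq M := by
  refine (frobeniusSq_nonneg M).lt_of_ne fun h => hM ?_
  have h1 := (Finset.sum_eq_zero_iff_of_nonneg (s := Finset.univ) (f := fun p => ∑ q, M p q ^ 2)
    fun _ _ => Finset.sum_nonneg fun _ _ => sq_nonneg _).1 h.symm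
  ext p q
  have h2 := (Finset.sum_eq_zero_iff_of_nonneg fun _ _ => sq_nonneg _).1
    (h1 p (Finset.mem_univ _)) q (Finset.mem_univ _)
  simpa using h2

theorem toEuclideanLin_apply_apply {n d : ℕ} (M : Matrix (Fin n) (Fin d) ℝ)
    (v : EuclideanSpace ℝ (Fin d)) (p : Fin n) :
    Matrix.toEuclideanLin M v p = ∑ q, M p q * v q := by
  simp [Matrix.toLpLin_apply, Matrix.mulVec, dotProduct]

/-- A finite set of points of `[a, b]` that contains the endpoints is enumerated by a monotone
sequence from `a` to `b`. -/
theorem exists_monotone_enumeration {a b : ℝ} (T : Finset ℝ) (hT : ∀ x ∈ T, x ∈ Set.Icc a b)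
    (ha : a ∈ T) (hb : b ∈ T) :
    ∃ (M : ℕ) (u : ℕ → ℝ), Monotone u ∧ u 0 = a ∧ u M = b ∧ ∀ x ∈ T, ∃ j ≤ M, u j = x := by
  have hc : 0 < T.card := Finset.card_pos.2 ⟨a, ha⟩
  let e := T.orderEmbOfFin rfl
  let u : ℕ → ℝ := fun i => e ⟨min i (T.card - 1), by omega⟩
  have hu : ∀ x ∈ T, ∃ j ≤ T.card - 1, u j = x := by
    intro x hx
    have : x ∈ Set.range e := by simpa [e] using hx
    obtain ⟨j, rfl⟩ := this
    refine ⟨j, by omega, ?_⟩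
    simp only [u]
    congr 1
    ext
    simp only
    omega
  have hmono : Monotone u := fun i j hij => e.monotone (by
    rw [Fin.mk_le_mk]
    omega)
  have hmem : ∀ i, u i ∈ Set.Icc a b := fun i => hT _ (T.orderEmbOfFin_mem rfl _)
  refine ⟨T.card - 1, u, hmono, ?_, ?_, hu⟩
  · obtain ⟨j, -, hj⟩ := hu a ha
    exact le_antisymm (hj ▸ hmono (Nat.zero_le j)) (hmem 0).1
  · obtain ⟨j, hj, hj'⟩ := hu b hb
    exact le_antisymm (hmem _).2 (hj' ▸ hmono hj)

/-- The increment of `g` between two points of a partition, as a sum over the partition. -/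
theorem sum_increments_indicator {E : Type*} [AddCommGroup E] {u : ℕ → ℝ} (hu : Monotone u)
    (g : ℝ → E) {M p q : ℕ} (hpq : p ≤ q) (hq : q ≤ M) :
    ∑ j ∈ Finset.range M, (if u (j + 1) ∈ Set.Ioc (u p) (u q) then g (u (j + 1)) - g (u j) else 0)
      = g (u q) - g (u p) := by
  have h1 : ∀ j ∈ Finset.range M,
      (if u (j + 1) ∈ Set.Ioc (u p) (u q) then g (u (j + 1)) - g (u j) else 0) =
      if j ∈ Finset.Ico p q then g (u (j + 1)) - g (u j) else 0 := by
    intro j _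
    by_cases hj : j ∈ Finset.Ico p q
    · rw [if_pos hj]
      rw [Finset.mem_Ico] at hj
      split_ifs with h
      · rfl
      · have h2 : u (j + 1) ≤ u p := by
          by_contra h3
          exact h ⟨not_le.1 h3, hu (by omega)⟩
        have h3 : u (j + 1) = u j := le_antisymm (h2.trans (hu hj.1)) (hu (by omega))
        simp [h3]
    · rw [if_neg hj]
      rw [Finset.mem_Ico, not_and_or, not_le, not_lt] at hj
      split_ifs with h
      · rcases hj with hj | hj
        · exact absurd h.1 (not_lt.2 (hu (by omega)))
        · have h3 : u (j + 1) = u j := le_antisymm (h.2.trans (hu hj)) (hu (by omega))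
          simp [h3]
      · rfl
  rw [Finset.sum_congr rfl h1, Finset.sum_ite_mem, Finset.inter_eq_right.2,
    Finset.sum_Ico_eq_sub _ hpq, Finset.sum_range_sub (fun j => g (u j)),
    Finset.sum_range_sub (fun j => g (u j))]
  · abel
  · intro j hj
    rw [Finset.mem_Ico] at hj
    exact Finset.mem_range.2 (by omega)

theorem lintegral_Ioc_eq_sum {u : ℕ → ℝ} (hu : Monotone u) (N : ℕ) (f : ℝ → ℝ≥0∞) :
    ∫⁻ s in Set.Ioc (u 0) (u N), f s =
      ∑ i ∈ Finset.range N, ∫⁻ s in Set.Ioc (u i) (u (i + 1)), f s := by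
  have h : Set.Ioc (u 0) (u N) = ⋃ i ∈ Finset.range N, Set.Ioc (u i) (u (i + 1)) := by
    rw [← hu.biUnion_Ico_Ioc_map_succ 0 N]
    simp
  rw [h, lintegral_biUnion_finset _ fun i _ => measurableSet_Ioc]
  exact fun i _ j _ hij => hu.pairwise_disjoint_on_Ioc_succ hij

namespace StepProcess

variable {Ω : Type*} {mΩ : MeasurableSpace Ω} {F : Filtration ℝ mΩ} {n d : ℕ} {a b : ℝ}

theorem t_mem_Icc (S : StepProcess F n d a b) {i : ℕ} (hi : i ≤ S.N) : S.t i ∈ Set.Icc a b :=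
  ⟨S.t_zero.symm.trans_le (S.mono (Nat.zero_le i)), (S.mono hi).trans_eq S.t_last⟩

theorem value_eq (S : StepProcess F n d a b) {i : ℕ} (hi : i < S.N) {s : ℝ}
    (hs : s ∈ Set.Ioc (S.t i) (S.t (i + 1))) (ω : Ω) : S.value s ω = S.ξ i ω := by
  rw [value, Finset.sum_eq_single_of_mem i (Finset.mem_range.2 hi), Set.indicator_of_mem hs]
  intro j _ hj
  refine Set.indicator_of_notMem (fun h => ?_) _
  exact Set.disjoint_left.1 (S.mono.pairwise_disjoint_on_Ioc_succ hj) h hs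

theorem exists_mem_Ioc (S : StepProcess F n d a b) {s : ℝ} (hs : s ∈ Set.Ioc a b) :
    ∃ i < S.N, s ∈ Set.Ioc (S.t i) (S.t (i + 1)) := by
  have h := S.mono.biUnion_Ico_Ioc_map_succ 0 S.N
  rw [S.t_zero, S.t_last] at h
  rw [← h] at hs
  simp only [Set.mem_iUnion, Set.mem_Ico] at hs
  obtain ⟨i, hi, hs⟩ := hs
  exact ⟨i, hi.2, hs⟩

/-- The integral of the squared Frobenius norm of a step process. -/
noncomputable def energy (S : StepProcess F n d a b) (ω : Ω) : ℝ :=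
  ∑ i ∈ Finset.range S.N, frobeniusSq (S.ξ i ω) * (S.t (i + 1) - S.t i)

theorem energy_nonneg (S : StepProcess F n d a b) (ω : Ω) : 0 ≤ S.energy ω :=
  Finset.sum_nonneg fun i _ =>
    mul_nonneg (frobeniusSq_nonneg _) (sub_nonneg.2 (S.mono (Nat.le_succ i)))

theorem lintegral_value (S : StepProcess F n d a b) (ω : Ω) :
    ∫⁻ s in Set.Ioc a b, ENNReal.ofReal (frobeniusSq (S.value s ω))
      = ENNReal.ofReal (S.energy ω) := by
  have h := lintegral_Ioc_eq_sum S.mono S.N fun s => ENNReal.ofReal (frobeniusSq (S.value s ω))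
  rw [S.t_zero, S.t_last] at h
  rw [h, energy, ENNReal.ofReal_sum_of_nonneg]
  · refine Finset.sum_congr rfl fun i hi => ?_
    rw [setLIntegral_congr_fun (g := fun _ => ENNReal.ofReal (frobeniusSq (S.ξ i ω)))
      measurableSet_Ioc]
    · simp [ENNReal.ofReal_mul (frobeniusSq_nonneg _)]
    · intro s hs
      simp only [S.value_eq (Finset.mem_range.1 hi) hs]
  · exact fun i _ => mul_nonneg (frobeniusSq_nonneg _) (sub_nonneg.2 (S.mono (Nat.le_succ i)))

theorem measurable_value_succ (S : StepProcess F n d a b) {u : ℕ → ℝ} (hu : Monotone u)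
    (hS : ∀ i ≤ S.N, S.t i ∈ Set.range u) (j : ℕ) (p : Fin n) (q : Fin d) :
    Measurable[F (u j)] fun ω => S.value (u (j + 1)) ω p q := by
  simp only [value, Matrix.sum_apply]
  refine Finset.measurable_sum _ fun i hi => ?_
  by_cases h : u (j + 1) ∈ Set.Ioc (S.t i) (S.t (i + 1))
  · simp only [Set.indicator_of_mem h]
    obtain ⟨l, hl⟩ := hS i (Finset.mem_range.1 hi).le
    refine (S.meas i p q).mono (F.mono ?_) le_rfl
    rw [← hl]
    refine hu (Nat.lt_succ_iff.1 ?_)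
    by_contra h'
    exact absurd h.1 (not_lt.2 (hl ▸ hu (not_lt.1 h')))
  · simp only [Set.indicator_of_notMem h, Matrix.zero_apply]
    exact measurable_const

theorem value_partition (S : StepProcess F n d a b) {u : ℕ → ℝ} (hu : Monotone u)
    (hS : ∀ i ≤ S.N, S.t i ∈ Set.range u) {j : ℕ} {s : ℝ}
    (hs : s ∈ Set.Ioc (u j) (u (j + 1))) (ω : Ω) : S.value (u (j + 1)) ω = S.value s ω := by
  refine Finset.sum_congr rfl fun i hi => ?_
  have h : ∀ l ≤ S.N, S.t l < u (j + 1) ↔ S.t l < s := by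
    intro l hl
    refine ⟨fun h => ?_, fun h => h.trans_le hs.2⟩
    obtain ⟨k, hk⟩ := hS l hl
    rw [← hk] at h ⊢
    refine (hu (Nat.lt_succ_iff.1 ?_)).trans_lt hs.1
    by_contra h'
    exact absurd h (not_lt.2 (hu (not_lt.1 h')))
  have hi := Finset.mem_range.1 hi
  have : u (j + 1) ∈ Set.Ioc (S.t i) (S.t (i + 1)) ↔ s ∈ Set.Ioc (S.t i) (S.t (i + 1)) := by
    simp only [Set.mem_Ioc, h i hi.le, ← not_lt, h (i + 1) hi]
  by_cases hm : s ∈ Set.Ioc (S.t i) (S.t (i + 1))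
  · rw [Set.indicator_of_mem hm, Set.indicator_of_mem (this.2 hm)]
  · rw [Set.indicator_of_notMem hm, Set.indicator_of_notMem (fun h => hm (this.1 h))]

theorem integral_partition (S : StepProcess F n d a b) {u : ℕ → ℝ} (hu : Monotone u) {M : ℕ}
    (hS : ∀ i ≤ S.N, ∃ j ≤ M, u j = S.t i)
    (w : ℝ → Ω → EuclideanSpace ℝ (Fin d)) (ω : Ω) :
    ∑ j ∈ Finset.range M,
      Matrix.toEuclideanLin (S.value (u (j + 1)) ω) (w (u (j + 1)) ω - w (u j) ω)
      = S.integral w ω := by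
  simp only [value, map_sum, LinearMap.sum_apply]
  rw [Finset.sum_comm, integral]
  refine Finset.sum_congr rfl fun i hi => ?_
  have hi := Finset.mem_range.1 hi
  obtain ⟨p, hp, hp'⟩ := hS i hi.le
  obtain ⟨q, hq, hq'⟩ := hS (i + 1) hi
  have key : ∀ p q, p ≤ M → q ≤ M → u p = S.t i → u q = S.t (i + 1) → p ≤ q →
      ∑ j ∈ Finset.range M, Matrix.toEuclideanLin ((Set.Ioc (S.t i) (S.t (i + 1))).indicator
        (fun _ => S.ξ i ω) (u (j + 1))) (w (u (j + 1)) ω - w (u j) ω) =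
      Matrix.toEuclideanLin (S.ξ i ω) (w (S.t (i + 1)) ω - w (S.t i) ω) := by
    intro p q hp hq hp' hq' hpq
    rw [← hp', ← hq', ← sum_increments_indicator hu (fun s => w s ω) hpq hq, map_sum]
    refine Finset.sum_congr rfl fun j _ => ?_
    simp only [Set.indicator_apply]
    split_ifs <;> simp
  rcases le_total p q with hpq | hpq
  · exact key p q hp hq hp' hq' hpq
  · have : S.t i = S.t (i + 1) :=
      le_antisymm (S.mono (Nat.le_succ i)) (hp' ▸ hq' ▸ hu hpq)
    exact key p p hp hp hp' (hp'.trans this) le_rfl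

/-- The difference of two step processes is a step process. -/
theorem exists_sub (S S' : StepProcess F n d a b) :
    ∃ R : StepProcess F n d a b,
      (∀ s ∈ Set.Ioc a b, ∀ ω, R.value s ω = S.value s ω - S'.value s ω) ∧
      ∀ (w : ℝ → Ω → EuclideanSpace ℝ (Fin d)) ω,
        R.integral w ω = S.integral w ω - S'.integral w ω := by
  classical
  let T : Finset ℝ := (Finset.range (S.N + 1)).image S.t ∪ (Finset.range (S'.N + 1)).image S'.t
  have hT : ∀ x ∈ T, x ∈ Set.Icc a b := by
    intro x hx
    simp only [T, Finset.mem_union, Finset.mem_image, Finset.mem_range] at hx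
    rcases hx with ⟨i, hi, rfl⟩ | ⟨i, hi, rfl⟩
    · exact S.t_mem_Icc (by omega)
    · exact S'.t_mem_Icc (by omega)
  have h1 : ∀ i ≤ S.N, S.t i ∈ T := fun i hi =>
    Finset.mem_union_left _ (Finset.mem_image_of_mem _ (Finset.mem_range.2 (by omega)))
  have h2 : ∀ i ≤ S'.N, S'.t i ∈ T := fun i hi =>
    Finset.mem_union_right _ (Finset.mem_image_of_mem _ (Finset.mem_range.2 (by omega)))
  obtain ⟨M, u, hu, hu0, huM, huT⟩ := exists_monotone_enumeration T hT
    (S.t_zero ▸ h1 0 (Nat.zero_le _)) (S.t_last ▸ h1 S.N le_rfl)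
  have h1' : ∀ i ≤ S.N, ∃ j ≤ M, u j = S.t i := fun i hi => huT _ (h1 i hi)
  have h2' : ∀ i ≤ S'.N, ∃ j ≤ M, u j = S'.t i := fun i hi => huT _ (h2 i hi)
  have h1'' : ∀ i ≤ S.N, S.t i ∈ Set.range u := fun i hi =>
    let ⟨j, _, hj⟩ := h1' i hi; ⟨j, hj⟩
  have h2'' : ∀ i ≤ S'.N, S'.t i ∈ Set.range u := fun i hi =>
    let ⟨j, _, hj⟩ := h2' i hi; ⟨j, hj⟩
  let R : StepProcess F n d a b :=
    { N := M
      t := u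
      mono := hu
      t_zero := hu0
      t_last := huM
      ξ := fun j ω => S.value (u (j + 1)) ω - S'.value (u (j + 1)) ω
      meas := fun j p q => (S.measurable_value_succ hu h1'' j p q).sub
        (S'.measurable_value_succ hu h2'' j p q) }
  refine ⟨R, fun s hs ω => ?_, fun w ω => ?_⟩
  · obtain ⟨j, hj, hs⟩ := R.exists_mem_Ioc hs
    rw [R.value_eq hj hs]
    exact congrArg₂ (· - ·) (S.value_partition hu h1'' hs ω) (S'.value_partition hu h2'' hs ω)
  · rw [← S.integral_partition hu h1', ← S'.integral_partition hu h2',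
      ← Finset.sum_sub_distrib, integral]
    refine Finset.sum_congr rfl fun j _ => ?_
    simp [R]

end StepProcess

namespace IsBrownianMotionOn

variable {Ω : Type*} {mΩ : MeasurableSpace Ω} {P : Measure Ω}
  {F : Filtration ℝ mΩ} {d : ℕ} {w : ℝ → Ω → EuclideanSpace ℝ (Fin d)} {T s t : ℝ}

theorem measurable_increment (hw : IsBrownianMotionOn P F T w) (hs : 0 ≤ s) (hst : s ≤ t)
    (ht : t ≤ T) (q : Fin d) : Measurable[F t] fun ω => (w t ω - w s ω) q := by
  have h1 : Measurable[F t] (w t) := hw.adapted t ⟨hs.trans hst, ht⟩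
  have h2 : Measurable[F t] (w s) := (hw.adapted s ⟨hs, hst.trans ht⟩).mono (F.mono hst) le_rfl
  have h3 : Measurable fun x : EuclideanSpace ℝ (Fin d) => x q := by fun_prop
  exact h3.comp (h1.sub h2)

theorem memLp_increment (hw : IsBrownianMotionOn P F T w) (hs : 0 ≤ s) (hst : s ≤ t)
    (ht : t ≤ T) (q : Fin d) : MemLp (fun ω => (w t ω - w s ω) q) 2 P := by
  have hl := hw.law s t hs hst ht
  have h := IsGaussian.memLp_dual
    (multivariateGaussian 0 ((t - s) • (1 : Matrix (Fin d) (Fin d) ℝ))) (EuclideanSpace.proj q) 2 (by simp)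
  rw [← hl.map_eq] at h
  exact (memLp_map_measure_iff h.1 hl.aemeasurable).1 h

theorem integral_increment (hw : IsBrownianMotionOn P F T w) (hs : 0 ≤ s) (hst : s ≤ t)
    (ht : t ≤ T) (q : Fin d) : ∫ ω, (w t ω - w s ω) q ∂P = 0 := by
  have hl := hw.law s t hs hst ht
  have h := hl.integral_comp (f := fun x => x q)
    (Measurable.aestronglyMeasurable (by fun_prop))
  have h2 := (EuclideanSpace.proj q : EuclideanSpace ℝ (Fin d) →L[ℝ] ℝ).integral_comp_id_comm
    (μ := multivariateGaussian 0 ((t - s) • (1 : Matrix (Fin d) (Fin d) ℝ)))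
    IsGaussian.integrable_id
  rw [integral_id_multivariateGaussian, map_zero] at h2
  exact h.trans h2

theorem integral_increment_mul_increment (hw : IsBrownianMotionOn P F T w) (hs : 0 ≤ s)
    (hst : s ≤ t) (ht : t ≤ T) (q r : Fin d) :
    ∫ ω, (w t ω - w s ω) q * (w t ω - w s ω) r ∂P = if q = r then t - s else 0 := by
  have hl := hw.law s t hs hst ht
  have hS : ((t - s) • (1 : Matrix (Fin d) (Fin d) ℝ)).PosSemidef :=
    Matrix.PosSemidef.one.smul (sub_nonneg.2 hst)
  have h := covariance_eval_multivariateGaussian (μ := 0) hS q r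
  rw [← hl.covariance_fun_comp (Measurable.aemeasurable (by fun_prop))
    (Measurable.aemeasurable (by fun_prop)), covariance, hw.integral_increment hs hst ht,
    hw.integral_increment hs hst ht] at h
  simpa [Matrix.one_apply] using h

theorem indepFun_increment (hw : IsBrownianMotionOn P F T w) (hs : 0 ≤ s) (hst : s ≤ t)
    (ht : t ≤ T) {β : Type*} {mβ : MeasurableSpace β} {u : Ω → β} (hu : Measurable[F s] u)
    {γ : Type*} {mγ : MeasurableSpace γ} {g : EuclideanSpace ℝ (Fin d) → γ} (hg : Measurable g) :
    IndepFun u (fun ω => g (w t ω - w s ω)) P := by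
  rw [IndepFun_iff_Indep]
  refine indep_of_indep_of_le_left (indep_of_indep_of_le_right (hw.indep s t hs hst ht).symm ?_)
    hu.comap_le
  rw [show (fun ω => g (w t ω - w s ω)) = g ∘ fun ω => w t ω - w s ω from rfl,
    ← MeasurableSpace.comap_comp]
  exact MeasurableSpace.comap_mono hg.comap_le

theorem memLp_mul_increment (hw : IsBrownianMotionOn P F T w) (hs : 0 ≤ s) (hst : s ≤ t)
    (ht : t ≤ T) {u : Ω → ℝ} (hu : Measurable[F s] u) (hu2 : MemLp u 2 P) (q : Fin d) :
    MemLp (fun ω => u ω * (w t ω - w s ω) q) 2 P := by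
  have hd := hw.memLp_increment hs hst ht q
  refine (memLp_two_iff_integrable_sq (hu2.1.mul hd.1)).2 ?_
  have hi : IndepFun (fun ω => u ω ^ 2) (fun ω => (w t ω - w s ω) q ^ 2) P :=
    hw.indepFun_increment hs hst ht (g := fun x => x q ^ 2) (hu.pow_const 2) (by fun_prop)
  exact (hi.integrable_mul hu2.integrable_sq hd.integrable_sq).congr
    (ae_of_all _ fun ω => (mul_pow _ _ 2).symm)

theorem integral_mul_increment (hw : IsBrownianMotionOn P F T w) (hs : 0 ≤ s) (hst : s ≤ t)
    (ht : t ≤ T) {u : Ω → ℝ} (hu : Measurable[F s] u) (q : Fin d) :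
    ∫ ω, u ω * (w t ω - w s ω) q ∂P = 0 := by
  have hi : IndepFun u (fun ω => (w t ω - w s ω) q) P :=
    hw.indepFun_increment hs hst ht (g := fun x => x q) hu (by fun_prop)
  rw [hi.integral_fun_mul_eq_mul_integral (hu.mono (F.le s) le_rfl).aestronglyMeasurable
    (hw.memLp_increment hs hst ht q).1, hw.integral_increment hs hst ht, mul_zero]

theorem integral_mul_increment_mul_increment (hw : IsBrownianMotionOn P F T w) (hs : 0 ≤ s)
    (hst : s ≤ t) (ht : t ≤ T) {u : Ω → ℝ} (hu : Measurable[F s] u) (q r : Fin d) :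
    ∫ ω, u ω * ((w t ω - w s ω) q * (w t ω - w s ω) r) ∂P
      = (∫ ω, u ω ∂P) * if q = r then t - s else 0 := by
  have hi : IndepFun u (fun ω => (w t ω - w s ω) q * (w t ω - w s ω) r) P :=
    hw.indepFun_increment hs hst ht (g := fun x => x q * x r) hu (by fun_prop)
  rw [hi.integral_fun_mul_eq_mul_integral (hu.mono (F.le s) le_rfl).aestronglyMeasurable
    ((hw.memLp_increment hs hst ht q).1.mul (hw.memLp_increment hs hst ht r).1),
    hw.integral_increment_mul_increment hs hst ht]

/-- The second moment of a linear combination of the components of an increment whose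
coefficients are known at the beginning. -/
theorem integral_sq_sum_mul_increment (hw : IsBrownianMotionOn P F T w) (hs : 0 ≤ s)
    (hst : s ≤ t) (ht : t ≤ T) {u : Fin d → Ω → ℝ} (hu : ∀ q, Measurable[F s] (u q))
    (hu2 : ∀ q, MemLp (u q) 2 P) :
    ∫ ω, (∑ q, u q ω * (w t ω - w s ω) q) ^ 2 ∂P = ∑ q, (∫ ω, u q ω ^ 2 ∂P) * (t - s) := by
  have hm := fun q => hw.memLp_mul_increment hs hst ht (hu q) (hu2 q) q
  have hi : ∀ q r, Integrable (fun ω => u q ω * (w t ω - w s ω) q *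
      (u r ω * (w t ω - w s ω) r)) P := fun q r => (hm q).integrable_mul (hm r)
  simp only [sq (∑ q, _), Finset.sum_mul_sum]
  rw [integral_finsetSum _ fun q _ => integrable_finsetSum _ fun r _ =>
    hi q r]
  refine Finset.sum_congr rfl fun q _ => ?_
  rw [integral_finsetSum _ fun r _ => hi q r]
  have h : ∀ r, ∫ ω, u q ω * (w t ω - w s ω) q * (u r ω * (w t ω - w s ω) r) ∂P
      = (∫ ω, u q ω * u r ω ∂P) * if q = r then t - s else 0 := by
    intro r
    have hqr : Measurable[F s] fun ω => u q ω * u r ω := (hu q).mul (hu r)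
    rw [← hw.integral_mul_increment_mul_increment hs hst ht hqr]
    congr 1
    ext ω
    ring
  rw [Finset.sum_congr rfl fun r _ => h r]
  simp [sq]

theorem integral_sq_add_sum_mul_increment (hw : IsBrownianMotionOn P F T w) (hs : 0 ≤ s)
    (hst : s ≤ t) (ht : t ≤ T) {X : Ω → ℝ} (hX : Measurable[F s] X) (hX2 : MemLp X 2 P)
    {u : Fin d → Ω → ℝ} (hu : ∀ q, Measurable[F s] (u q)) (hu2 : ∀ q, MemLp (u q) 2 P) :
    ∫ ω, (X ω + ∑ q, u q ω * (w t ω - w s ω) q) ^ 2 ∂P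
      = ∫ ω, X ω ^ 2 ∂P + ∑ q, (∫ ω, u q ω ^ 2 ∂P) * (t - s) := by
  have hm := fun q => hw.memLp_mul_increment hs hst ht (hu q) (hu2 q) q
  have hY : MemLp (fun ω => ∑ q, u q ω * (w t ω - w s ω) q) 2 P :=
    memLp_finsetSum _ fun q _ => hm q
  have hi : ∀ q, Integrable (fun ω => X ω * (u q ω * (w t ω - w s ω) q)) P :=
    fun q => hX2.integrable_mul (hm q)
  have hXY : Integrable (fun ω => 2 * (X ω * ∑ q, u q ω * (w t ω - w s ω) q)) P :=
    (hX2.integrable_mul hY).const_mul 2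
  have h0 : ∫ ω, 2 * (X ω * ∑ q, u q ω * (w t ω - w s ω) q) ∂P = 0 := by
    rw [integral_const_mul]
    simp only [Finset.mul_sum]
    rw [integral_finsetSum _ fun q _ => hi q, Finset.sum_eq_zero, mul_zero]
    intro q _
    have hXu : Measurable[F s] fun ω => X ω * u q ω := hX.mul (hu q)
    simp only [← mul_assoc]
    exact hw.integral_mul_increment hs hst ht hXu q
  have h1 : Integrable (fun ω => X ω ^ 2 + 2 * (X ω * ∑ q, u q ω * (w t ω - w s ω) q)) P :=
    hX2.integrable_sq.add hXY
  simp only [add_sq, mul_assoc]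
  rw [integral_add h1 hY.integrable_sq,
    integral_add hX2.integrable_sq hXY, h0, add_zero,
    hw.integral_sq_sum_mul_increment hs hst ht hu hu2]

end IsBrownianMotionOn

namespace StepProcess

variable {Ω : Type*} {mΩ : MeasurableSpace Ω} {P : Measure Ω} {F : Filtration ℝ mΩ} {n d : ℕ}
  {a b T : ℝ} {w : ℝ → Ω → EuclideanSpace ℝ (Fin d)}

theorem measurable_increment (S : StepProcess F n d a b) (hw : IsBrownianMotionOn P F T w)
    (ha : 0 ≤ a) (hb : b ≤ T) {i : ℕ} (hi : i < S.N) (p : Fin n) :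
    Measurable[F (S.t (i + 1))] fun ω =>
      Matrix.toEuclideanLin (S.ξ i ω) (w (S.t (i + 1)) ω - w (S.t i) ω) p := by
  simp only [toEuclideanLin_apply_apply]
  refine Finset.measurable_sum _ fun q _ => Measurable.mul ?_ ?_
  · exact (S.meas i p q).mono (F.mono (S.mono (Nat.le_succ i))) le_rfl
  · exact hw.measurable_increment (ha.trans (S.t_mem_Icc hi.le).1) (S.mono (Nat.le_succ i))
      ((S.t_mem_Icc hi).2.trans hb) q

theorem measurable_integral (S : StepProcess F n d a b) (hw : IsBrownianMotionOn P F T w)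
    (ha : 0 ≤ a) (hb : b ≤ T) : Measurable (S.integral w) := by
  have h : ∀ p, Measurable fun ω => S.integral w ω p := by
    intro p
    simp only [integral, WithLp.ofLp_sum, Finset.sum_apply]
    exact Finset.measurable_sum _ fun i hi =>
      (S.measurable_increment hw ha hb (Finset.mem_range.1 hi) p).mono (F.le _) le_rfl
  exact (WithLp.measurable_toLp 2 _).comp (measurable_pi_lambda _ h)

theorem integral_sq_partial_sum (S : StepProcess F n d a b) (hw : IsBrownianMotionOn P F T w)
    (ha : 0 ≤ a) (hb : b ≤ T)
    (hS : ∀ i < S.N, S.t i < S.t (i + 1) → ∀ p q, MemLp (fun ω => S.ξ i ω p q) 2 P) (p : Fin n)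
    {k : ℕ} (hk : k ≤ S.N) :
    Measurable[F (S.t k)] (fun ω => ∑ i ∈ Finset.range k,
      Matrix.toEuclideanLin (S.ξ i ω) (w (S.t (i + 1)) ω - w (S.t i) ω) p) ∧
    MemLp (fun ω => ∑ i ∈ Finset.range k,
      Matrix.toEuclideanLin (S.ξ i ω) (w (S.t (i + 1)) ω - w (S.t i) ω) p) 2 P ∧
    ∫ ω, (∑ i ∈ Finset.range k,
      Matrix.toEuclideanLin (S.ξ i ω) (w (S.t (i + 1)) ω - w (S.t i) ω) p) ^ 2 ∂P
      = ∑ i ∈ Finset.range k, ∑ q, (∫ ω, S.ξ i ω p q ^ 2 ∂P) * (S.t (i + 1) - S.t i) := by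
  induction k with
  | zero => simp
  | succ k ih =>
    obtain ⟨ih1, ih2, ih3⟩ := ih (by omega)
    have h0 : 0 ≤ S.t k := ha.trans (S.t_mem_Icc (by omega)).1
    have h1 : S.t k ≤ S.t (k + 1) := S.mono (Nat.le_succ k)
    have h2 : S.t (k + 1) ≤ T := (S.t_mem_Icc hk).2.trans hb
    have hme := ih1.mono (F.mono h1) le_rfl
    have hinc := S.measurable_increment hw ha hb hk p
    simp only [Finset.sum_range_succ]
    refine ⟨hme.add hinc, ?_⟩
    rcases h1.eq_or_lt with h | h
    · simp only [← h, sub_self, map_zero, WithLp.ofLp_zero, Pi.zero_apply, add_zero, mul_zero,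
        Finset.sum_const_zero]
      exact ⟨ih2, ih3⟩
    · have hL := hS k hk h
      have hY : ∀ q, MemLp (fun ω => S.ξ k ω p q * (w (S.t (k + 1)) ω - w (S.t k) ω) q) 2 P :=
        fun q => hw.memLp_mul_increment h0 h1 h2 (S.meas k p q) (hL p q) q
      simp only [toEuclideanLin_apply_apply] at ih1 ih2 ih3 ⊢
      have hYs : MemLp (fun ω => ∑ q, S.ξ k ω p q * (w (S.t (k + 1)) ω - w (S.t k) ω) q) 2 P :=
        memLp_finsetSum _ fun q _ => hY q
      refine ⟨ih2.add hYs, ?_⟩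
      rw [hw.integral_sq_add_sum_mul_increment h0 h1 h2 ih1 ih2 (S.meas k p) (hL p), ih3]

/-- The Itô isometry for step processes. -/
theorem lintegral_integral_sq (S : StepProcess F n d a b) (hw : IsBrownianMotionOn P F T w)
    (ha : 0 ≤ a) (hb : b ≤ T) (hS : ∫⁻ ω, ENNReal.ofReal (S.energy ω) ∂P ≠ ∞) :
    ∫⁻ ω, ‖S.integral w ω‖ₑ ^ 2 ∂P = ∫⁻ ω, ENNReal.ofReal (S.energy ω) ∂P := by
  have hle : ∀ i < S.N, ∀ p q ω,
      S.ξ i ω p q ^ 2 * (S.t (i + 1) - S.t i) ≤ S.energy ω := by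
    intro i hi p q ω
    have h1 : S.ξ i ω p q ^ 2 ≤ frobeniusSq (S.ξ i ω) :=
      (Finset.single_le_sum (f := fun q => S.ξ i ω p q ^ 2) (fun _ _ => sq_nonneg _)
        (Finset.mem_univ q)).trans
        (Finset.single_le_sum (f := fun p => ∑ q, S.ξ i ω p q ^ 2)
          (fun _ _ => Finset.sum_nonneg fun _ _ => sq_nonneg _) (Finset.mem_univ p))
    have h2 : ∀ j, 0 ≤ S.t (j + 1) - S.t j := fun j => sub_nonneg.2 (S.mono (Nat.le_succ j))
    exact (mul_le_mul_of_nonneg_right h1 (h2 i)).trans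
      (Finset.single_le_sum (f := fun i => frobeniusSq (S.ξ i ω) * (S.t (i + 1) - S.t i))
        (fun j _ => mul_nonneg (frobeniusSq_nonneg _) (h2 j)) (Finset.mem_range.2 hi))
  have hmeas : ∀ i p q, Measurable fun ω => S.ξ i ω p q :=
    fun i p q => (S.meas i p q).mono (F.le _) le_rfl
  have hEm : Measurable S.energy := by
    unfold energy frobeniusSq
    fun_prop
  have hEi : Integrable S.energy P :=
    (lintegral_ofReal_ne_top_iff_integrable hEm.aestronglyMeasurable
      (ae_of_all _ S.energy_nonneg)).1 hS
  have hL : ∀ i < S.N, S.t i < S.t (i + 1) → ∀ p q, MemLp (fun ω => S.ξ i ω p q) 2 P := by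
    intro i hi h p q
    rw [memLp_two_iff_integrable_sq (hmeas i p q).aestronglyMeasurable]
    have h3 : Integrable (fun ω => S.ξ i ω p q ^ 2 * (S.t (i + 1) - S.t i)) P := by
      refine hEi.mono' (by fun_prop) (ae_of_all _ fun ω => ?_)
      rw [Real.norm_of_nonneg (mul_nonneg (sq_nonneg _) (sub_pos.2 h).le)]
      exact hle i hi p q ω
    exact (integrable_mul_const_iff (sub_pos.2 h).ne'.isUnit _).1 h3
  have key := fun p => S.integral_sq_partial_sum hw ha hb hL p le_rfl
  have hI : ∀ ω, ‖S.integral w ω‖ₑ ^ 2 = ENNReal.ofReal (∑ p, (∑ i ∈ Finset.range S.N,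
      Matrix.toEuclideanLin (S.ξ i ω) (w (S.t (i + 1)) ω - w (S.t i) ω) p) ^ 2) := by
    intro ω
    rw [← ofReal_norm, ← ENNReal.ofReal_pow (norm_nonneg _),
      EuclideanSpace.real_norm_sq_eq]
    simp [integral]
  simp only [hI]
  rw [← ofReal_integral_eq_lintegral_ofReal, ← ofReal_integral_eq_lintegral_ofReal hEi]
  · congr 1
    rw [integral_finsetSum _ fun p _ => (key p).2.1.integrable_sq]
    simp only [(key _).2.2]
    rw [Finset.sum_comm]
    unfold energy
    have h4 : ∀ i ∈ Finset.range S.N, ∀ p q,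
        Integrable (fun ω => S.ξ i ω p q ^ 2 * (S.t (i + 1) - S.t i)) P := by
      intro i hi p q
      rcases (S.mono (Nat.le_succ i)).eq_or_lt with h | h
      · simp [← h]
      · exact (hL i (Finset.mem_range.1 hi) h p q).integrable_sq.mul_const _
    simp only [frobeniusSq, Finset.sum_mul]
    rw [integral_finsetSum]
    · refine Finset.sum_congr rfl fun i hi => ?_
      rw [integral_finsetSum]
      · refine Finset.sum_congr rfl fun p _ => ?_
        rw [integral_finsetSum]
        · simp only [integral_mul_const]
        · exact fun q _ => h4 i hi p q
      · exact fun p _ => integrable_finsetSum _ fun q _ => h4 i hi p q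
    · exact fun i hi => integrable_finsetSum _ fun p _ => integrable_finsetSum _ fun q _ =>
        h4 i hi p q
  · exact ae_of_all _ S.energy_nonneg
  · exact integrable_finsetSum _ fun p _ => (key p).2.1.integrable_sq
  · exact ae_of_all _ fun ω => Finset.sum_nonneg fun _ _ => sq_nonneg _

end StepProcess

theorem measurable_frobeniusSq_of_entries {α : Type*} [MeasurableSpace α] {n d : ℕ}
    {H : α → Matrix (Fin n) (Fin d) ℝ} (hH : ∀ p q, Measurable fun x => H x p q) :
    Measurable fun x => frobeniusSq (H x) := by
  unfold frobeniusSq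
  fun_prop

theorem ofReal_frobeniusSq {n d : ℕ} (M : Matrix (Fin n) (Fin d) ℝ) :
    ENNReal.ofReal (frobeniusSq M) = ∑ p, ∑ q, ENNReal.ofReal (M p q ^ 2) :=
  (ENNReal.ofReal_sum_of_nonneg fun _ _ => Finset.sum_nonneg fun _ _ => sq_nonneg _).trans
    (Finset.sum_congr rfl fun _ _ => ENNReal.ofReal_sum_of_nonneg fun _ _ => sq_nonneg _)

theorem lintegral_frobeniusSq {α : Type*} [MeasurableSpace α] {μ : Measure α} {n d : ℕ}
    {H : α → Matrix (Fin n) (Fin d) ℝ} (hH : ∀ p q, Measurable fun x => H x p q) :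
    ∫⁻ x, ENNReal.ofReal (frobeniusSq (H x)) ∂μ =
      ∑ p, ∑ q, ∫⁻ x, ENNReal.ofReal (H x p q ^ 2) ∂μ := by
  have hm : ∀ p q, Measurable fun x => ENNReal.ofReal (H x p q ^ 2) :=
    fun p q => ((hH p q).pow_const 2).ennreal_ofReal
  simp only [ofReal_frobeniusSq]
  rw [lintegral_finsetSum _ fun p _ => Finset.measurable_sum _ fun q _ => hm p q]
  exact Finset.sum_congr rfl fun p _ => lintegral_finsetSum _ fun q _ => hm p q

/-- The entries of a matrix-valued function with integrable squared norm are square-integrable. -/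
theorem memLp_entry {α : Type*} [MeasurableSpace α] {μ : Measure α} {n d : ℕ}
    {H : α → Matrix (Fin n) (Fin d) ℝ} (hH : ∀ p q, Measurable fun x => H x p q)
    (hH2 : ∫⁻ x, ENNReal.ofReal (frobeniusSq (H x)) ∂μ < ∞) (p : Fin n) (q : Fin d) :
    MemLp (fun x => H x p q) 2 μ := by
  rw [memLp_two_iff_integrable_sq (hH p q).aestronglyMeasurable]
  refine (lintegral_ofReal_ne_top_iff_integrable ((hH p q).pow_const 2).aestronglyMeasurable
    (ae_of_all _ fun _ => sq_nonneg _)).1 (LE.le.trans_lt ?_ hH2).ne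
  refine lintegral_mono fun x => ?_
  rw [ofReal_frobeniusSq]
  exact (Finset.single_le_sum (f := fun q => ENNReal.ofReal (H x p q ^ 2))
    (fun _ _ => zero_le) (Finset.mem_univ q)).trans
    (Finset.single_le_sum (f := fun p => ∑ q, ENNReal.ofReal (H x p q ^ 2))
      (fun _ _ => zero_le) (Finset.mem_univ p))

theorem aemeasurable_frobeniusSq_of_entries {α : Type*} [MeasurableSpace α] {μ : Measure α}
    {n d : ℕ} {H : α → Matrix (Fin n) (Fin d) ℝ} (hH : ∀ p q, AEMeasurable (fun x => H x p q) μ) :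
    AEMeasurable (fun x => frobeniusSq (H x)) μ := by
  unfold frobeniusSq
  fun_prop

theorem ofReal_frobeniusSq_sub_le {n d : ℕ} (M M' : Matrix (Fin n) (Fin d) ℝ) :
    ENNReal.ofReal (frobeniusSq (M - M')) ≤
      2 * ENNReal.ofReal (frobeniusSq M) + 2 * ENNReal.ofReal (frobeniusSq M') := by
  have h2 : (2 : ℝ≥0∞) = ENNReal.ofReal 2 := by simp
  rw [h2, ← ENNReal.ofReal_mul zero_le_two, ← ENNReal.ofReal_mul zero_le_two,
    ← ENNReal.ofReal_add (mul_nonneg zero_le_two (frobeniusSq_nonneg _))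
      (mul_nonneg zero_le_two (frobeniusSq_nonneg _))]
  refine ENNReal.ofReal_le_ofReal ?_
  have h := frobeniusSq_add_le M (-M')
  rwa [frobeniusSq_neg, ← sub_eq_add_neg] at h

namespace StepProcess

variable {Ω : Type*} {mΩ : MeasurableSpace Ω} {P : Measure Ω} {F : Filtration ℝ mΩ} {n d : ℕ}
  {a b T : ℝ} {w : ℝ → Ω → EuclideanSpace ℝ (Fin d)}

theorem measurable_value (S : StepProcess F n d a b) (ω : Ω) (p : Fin n) (q : Fin d) :
    Measurable fun s => S.value s ω p q := by
  simp only [value, Matrix.sum_apply]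
  refine Finset.measurable_sum _ fun i _ => ?_
  have h : (fun s => (Set.Ioc (S.t i) (S.t (i + 1))).indicator (fun _ => S.ξ i ω) s p q) =
      (Set.Ioc (S.t i) (S.t (i + 1))).indicator (fun _ => S.ξ i ω p q) := by
    ext s
    simp only [Set.indicator_apply]
    split_ifs <;> rfl
  rw [h]
  exact measurable_const.indicator measurableSet_Ioc

/-- The energy of the difference of two step processes is controlled by their distances to a
third process. -/
theorem energy_le (R : StepProcess F n d a b) {S S' : StepProcess F n d a b}
    {H : ℝ → Ω → Matrix (Fin n) (Fin d) ℝ} {ω : Ω}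
    (hH : ∀ p q, AEMeasurable (fun s => H s ω p q) (volume.restrict (Set.Ioc a b)))
    (hR : ∀ s ∈ Set.Ioc a b, ∀ ω, R.value s ω = S.value s ω - S'.value s ω) :
    ENNReal.ofReal (R.energy ω) ≤
      2 * (∫⁻ s in Set.Ioc a b, ENNReal.ofReal (frobeniusSq (S.value s ω - H s ω))) +
      2 * ∫⁻ s in Set.Ioc a b, ENNReal.ofReal (frobeniusSq (S'.value s ω - H s ω)) := by
  have hm : AEMeasurable (fun s => ENNReal.ofReal (frobeniusSq (S.value s ω - H s ω)))
      (volume.restrict (Set.Ioc a b)) :=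
    (aemeasurable_frobeniusSq_of_entries fun p q =>
      (S.measurable_value ω p q).aemeasurable.sub (hH p q)).ennreal_ofReal
  rw [← R.lintegral_value, ← lintegral_const_mul' _ _ (by simp),
    ← lintegral_const_mul' _ _ (by simp), ← lintegral_add_left' (hm.const_mul 2)]
  refine setLIntegral_mono' measurableSet_Ioc fun s hs => ?_
  refine le_trans (le_of_eq ?_) (ofReal_frobeniusSq_sub_le _ _)
  rw [hR s hs, sub_sub_sub_cancel_right]

/-- The energy of a step process up to and including its `i`-th step. -/
noncomputable def energyUpTo (S : StepProcess F n d a b) (i : ℕ) (ω : Ω) : ℝ :=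
  ∑ j ∈ Finset.range (i + 1), frobeniusSq (S.ξ j ω) * (S.t (j + 1) - S.t j)

open Classical in
/-- The step process that is stopped before its energy exceeds `δ`. -/
noncomputable def truncate (S : StepProcess F n d a b) (δ : ℝ) : StepProcess F n d a b where
  N := S.N
  t := S.t
  mono := S.mono
  t_zero := S.t_zero
  t_last := S.t_last
  ξ i ω := if S.energyUpTo i ω ≤ δ then S.ξ i ω else 0
  meas i p q := by
    have h1 : ∀ j ∈ Finset.range (i + 1), Measurable[F (S.t i)]
        fun ω => frobeniusSq (S.ξ j ω) * (S.t (j + 1) - S.t j) := fun j hj =>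
      Measurable.mul_const (@measurable_frobeniusSq_of_entries Ω (F (S.t i)) n d _ fun p q =>
        (S.meas j p q).mono (F.mono (S.mono (Nat.lt_succ_iff.1 (Finset.mem_range.1 hj)))) le_rfl) _
    have h2 : Measurable[F (S.t i)] (S.energyUpTo i) := Finset.measurable_sum _ h1
    have h3 : (fun ω => (if S.energyUpTo i ω ≤ δ then S.ξ i ω else 0) p q) =
        fun ω => if S.energyUpTo i ω ≤ δ then S.ξ i ω p q else 0 := by
      ext ω
      split_ifs <;> rfl
    rw [h3]
    exact Measurable.ite (measurableSet_le h2 measurable_const) (S.meas i p q) measurable_const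

theorem energy_truncate_le (S : StepProcess F n d a b) {δ : ℝ} (hδ : 0 ≤ δ) (ω : Ω) :
    (S.truncate δ).energy ω ≤ δ := by
  have h0 : ∀ j, 0 ≤ S.t (j + 1) - S.t j := fun j => sub_nonneg.2 (S.mono (Nat.le_succ j))
  have h : ∀ k, ∑ i ∈ Finset.range k, frobeniusSq ((S.truncate δ).ξ i ω) * (S.t (i + 1) - S.t i)
      ≤ min δ (∑ i ∈ Finset.range k, frobeniusSq (S.ξ i ω) * (S.t (i + 1) - S.t i)) := by
    intro k
    induction k with
    | zero => simpa using hδ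
    | succ k ih =>
      rw [le_min_iff] at ih ⊢
      rw [Finset.sum_range_succ]
      by_cases hk : S.energyUpTo k ω ≤ δ
      · have h1 : (S.truncate δ).ξ k ω = S.ξ k ω := if_pos hk
        rw [h1, Finset.sum_range_succ]
        rw [energyUpTo, Finset.sum_range_succ] at hk
        constructor <;> linarith [ih.2]
      · have h1 : (S.truncate δ).ξ k ω = 0 := if_neg hk
        rw [h1, Finset.sum_range_succ]
        have := mul_nonneg (frobeniusSq_nonneg (S.ξ k ω)) (h0 k)
        constructor <;> simp only [frobeniusSq_zero, zero_mul, add_zero] <;> linarith [ih.1, ih.2]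
  exact (h S.N).trans (min_le_left _ _)

theorem integral_truncate (S : StepProcess F n d a b) {δ : ℝ} {ω : Ω} (h : S.energy ω ≤ δ) :
    (S.truncate δ).integral w ω = S.integral w ω := by
  refine Finset.sum_congr rfl fun i hi => ?_
  have h1 : S.energyUpTo i ω ≤ S.energy ω :=
    Finset.sum_le_sum_of_subset_of_nonneg
      (Finset.range_subset_range.2 (Nat.succ_le_of_lt (Finset.mem_range.1 hi)))
      fun j _ _ => mul_nonneg (frobeniusSq_nonneg _) (sub_nonneg.2 (S.mono (Nat.le_succ j)))
  have h2 : (S.truncate δ).ξ i ω = S.ξ i ω := if_pos (h1.trans h)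
  rw [h2]
  rfl

/-- The tail of an elementary stochastic integral is controlled by the tail of the energy. -/
theorem measure_le_integral_le [IsProbabilityMeasure P] (S : StepProcess F n d a b)
    (hw : IsBrownianMotionOn P F T w) (ha : 0 ≤ a) (hb : b ≤ T) {δ : ℝ} (hδ : 0 ≤ δ) {ε : ℝ≥0∞}
    (hε : ε ≠ 0) (hε' : ε ≠ ∞) :
    P {ω | ε ≤ ‖S.integral w ω‖ₑ} ≤ ENNReal.ofReal δ / ε ^ 2 + P {ω | δ < S.energy ω} := by
  have h1 : ∫⁻ ω, ENNReal.ofReal ((S.truncate δ).energy ω) ∂P ≤ ENNReal.ofReal δ :=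
    (lintegral_mono fun ω => ENNReal.ofReal_le_ofReal (S.energy_truncate_le hδ ω)).trans (by simp)
  have h2 := (S.truncate δ).lintegral_integral_sq hw ha hb (h1.trans_lt ENNReal.ofReal_lt_top).ne
  have h3 : P {ω | ε ^ 2 ≤ ‖(S.truncate δ).integral w ω‖ₑ ^ 2} ≤ ENNReal.ofReal δ / ε ^ 2 := by
    refine (meas_ge_le_lintegral_div ?_ (by simpa using hε) (by simpa using hε')).trans ?_
    · exact (((S.truncate δ).measurable_integral hw ha hb).enorm.pow_const 2).aemeasurable
    · exact ENNReal.div_le_div_right (h2.trans_le h1) _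
  refine (measure_mono ?_).trans ((measure_union_le _ _).trans (add_le_add_left h3 _))
  intro ω hω
  by_cases h : S.energy ω ≤ δ
  · left
    simp only [Set.mem_ofPred_eq, S.integral_truncate h] at hω ⊢
    gcongr
  · right
    exact not_le.1 h

theorem tendstoInMeasure_integral_zero [IsProbabilityMeasure P] {S : ℕ → StepProcess F n d a b}
    (hw : IsBrownianMotionOn P F T w) (ha : 0 ≤ a) (hb : b ≤ T)
    (hS : ∀ δ : ℝ, 0 < δ → Tendsto (fun m => P {ω | δ < (S m).energy ω}) atTop (𝓝 0)) :
    TendstoInMeasure P (fun m => (S m).integral w) atTop fun _ => 0 := by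
  refine tendstoInMeasure_of_ne_top fun ε hε hε' => ?_
  simp only [edist_zero_right]
  rw [ENNReal.tendsto_nhds_zero]
  intro η hη
  have h1 : Tendsto (fun δ => ENNReal.ofReal δ / ε ^ 2) (𝓝[>] 0) (𝓝 0) := by
    have h := ENNReal.Tendsto.div_const (b := ε ^ 2)
      (ENNReal.tendsto_ofReal (tendsto_id (α := ℝ) (x := 𝓝 0)))
      (Or.inr (by simpa using hε.ne'))
    simp only [ENNReal.ofReal_zero, ENNReal.zero_div] at h
    exact h.mono_left nhdsWithin_le_nhds
  have hη2 : 0 < η / 2 := ENNReal.half_pos hη.ne'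
  obtain ⟨δ, hδ, hδ0⟩ := ((ENNReal.tendsto_nhds_zero.1 h1 _ hη2).and self_mem_nhdsWithin).exists
  filter_upwards [ENNReal.tendsto_nhds_zero.1 (hS δ hδ0) _ hη2] with m hm
  refine ((S m).measure_le_integral_le hw ha hb (le_of_lt hδ0) hε.ne' hε').trans ?_
  exact (add_le_add hδ hm).trans_eq (ENNReal.add_halves η)

end StepProcess

/-- The Itô integral is unique up to a null set. -/
theorem IsItoIntegral.ae_eq {Ω : Type*} {mΩ : MeasurableSpace Ω} {P : Measure Ω}
    [IsProbabilityMeasure P] {F : Filtration ℝ mΩ} {n d : ℕ} {a b T : ℝ}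
    {w : ℝ → Ω → EuclideanSpace ℝ (Fin d)} (hw : IsBrownianMotionOn P F T w) (ha : 0 ≤ a)
    (hb : b ≤ T) {H : ℝ → Ω → Matrix (Fin n) (Fin d) ℝ}
    (hH : ∀ ω p q, AEMeasurable (fun s => H s ω p q) (volume.restrict (Set.Ioc a b)))
    {I I' : Ω → EuclideanSpace ℝ (Fin n)} (hI : IsItoIntegral P F w a b H I)
    (hI' : IsItoIntegral P F w a b H I') : I =ᵐ[P] I' := by
  obtain ⟨S, hS, hSI⟩ := hI
  obtain ⟨S', hS', hSI'⟩ := hI'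
  choose R hR hRI using fun m => (S m).exists_sub (S' m)
  have henergy := fun m ω => (R m).energy_le (hH ω) (hR m)
  have h2 : TendstoInMeasure P (fun m => (R m).integral w) atTop fun _ => 0 := by
    refine StepProcess.tendstoInMeasure_integral_zero hw ha hb fun δ hδ => ?_
    have hδ4 : 0 < ENNReal.ofReal (δ / 4) := ENNReal.ofReal_pos.2 (by positivity)
    have h3 := (hS _ hδ4).add (hS' _ hδ4)
    rw [add_zero] at h3
    refine tendsto_of_tendsto_of_tendsto_of_le_of_le tendsto_const_nhds h3 (fun _ => zero_le)
      fun m => (measure_mono fun ω hω => ?_).trans (measure_union_le _ _)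
    by_contra hn
    simp only [Set.mem_union, Set.mem_ofPred_eq, not_or, not_le] at hn hω
    have h4 := (henergy m ω).trans (add_le_add (mul_le_mul_right hn.1.le 2)
      (mul_le_mul_right hn.2.le 2))
    have h5 : (2 : ℝ≥0∞) = ENNReal.ofReal 2 := by simp
    rw [h5, ← ENNReal.ofReal_mul zero_le_two, ← ENNReal.ofReal_add (by positivity) (by positivity),
      ENNReal.ofReal_le_ofReal_iff (by positivity)] at h4
    linarith
  obtain ⟨k₁, hk₁, h₁⟩ := hSI.exists_seq_tendsto_ae
  obtain ⟨k₂, hk₂, h₂⟩ := (hSI'.comp hk₁.tendsto_atTop).exists_seq_tendsto_ae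
  obtain ⟨k₃, hk₃, h₃⟩ :=
    ((h2.comp hk₁.tendsto_atTop).comp hk₂.tendsto_atTop).exists_seq_tendsto_ae
  filter_upwards [h₁, h₂, h₃] with ω h₁ h₂ h₃
  have h := ((h₁.comp hk₂.tendsto_atTop).sub h₂).comp hk₃.tendsto_atTop
  refine sub_eq_zero.1 (tendsto_nhds_unique h (h₃.congr fun m => ?_))
  exact hRI _ w ω

theorem lintegral_enorm_sq {α E : Type*} [MeasurableSpace α] {μ : Measure α}
    [NormedAddCommGroup E] (f : α → E) : ∫⁻ x, ‖f x‖ₑ ^ 2 ∂μ = eLpNorm f 2 μ ^ 2 := by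
  have h := eLpNorm_nnreal_pow_eq_lintegral (f := f) (p := 2) (μ := μ) two_ne_zero
  norm_num at h
  exact h.symm

/-- The mean-square distance to a constant, split at the average. -/
theorem lintegral_sq_const_sub {α : Type*} [MeasurableSpace α] {μ : Measure α}
    [IsFiniteMeasure μ] {f : α → ℝ} (hf : MemLp f 2 μ) (c : ℝ) :
    ∫⁻ x, ENNReal.ofReal ((c - f x) ^ 2) ∂μ =
      ∫⁻ x, ENNReal.ofReal (((⨍ y, f y ∂μ) - f x) ^ 2) ∂μ +
      ENNReal.ofReal ((c - ⨍ y, f y ∂μ) ^ 2) * μ Set.univ := by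
  have hfi : Integrable f μ := hf.integrable one_le_two
  have hc : ∀ c : ℝ, Integrable (fun x => (c - f x) ^ 2) μ :=
    fun c => ((memLp_const c).sub hf).integrable_sq
  rw [← ofReal_integral_eq_lintegral_ofReal (hc _) (ae_of_all _ fun _ => sq_nonneg _),
    ← ofReal_integral_eq_lintegral_ofReal (hc _) (ae_of_all _ fun _ => sq_nonneg _)]
  set m := ⨍ y, f y ∂μ
  have h0 : ∫ x, (m - f x) ∂μ = 0 := integral_average_sub hfi
  have h2 : Integrable (fun x => 2 * (c - m) * (m - f x)) μ :=
    ((integrable_const m).sub hfi).const_mul _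
  have h1 : ∫ x, (c - f x) ^ 2 ∂μ =
      ∫ x, (m - f x) ^ 2 ∂μ + ∫ x, ((c - m) ^ 2 + 2 * (c - m) * (m - f x)) ∂μ := by
    have h3 : Integrable (fun x => (c - m) ^ 2 + 2 * (c - m) * (m - f x)) μ :=
      (integrable_const _).add h2
    rw [← integral_add (hc m) h3]
    congr 1
    ext x
    ring
  rw [h1, integral_add (integrable_const _) h2, integral_const_mul, h0, integral_const,
    smul_eq_mul, mul_zero, add_zero, ENNReal.ofReal_add (integral_nonneg fun _ => sq_nonneg _)
    (by positivity), mul_comm (μ.real _), ENNReal.ofReal_mul (sq_nonneg _), ofReal_measureReal]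

/-- The points of the partition of `[a, b]` into `m + 1` intervals of equal length. -/
noncomputable def uniformPartition (a b : ℝ) (m i : ℕ) : ℝ := a + i * ((b - a) / (m + 1))

section uniformPartition

variable {a b : ℝ}

theorem uniformPartition_mono (hab : a ≤ b) (m : ℕ) : Monotone (uniformPartition a b m) := by
  intro i j hij
  have : 0 ≤ (b - a) / (m + 1) := div_nonneg (sub_nonneg.2 hab) (by positivity)
  unfold uniformPartition
  gcongr

@[simp]
theorem uniformPartition_zero (m : ℕ) : uniformPartition a b m 0 = a := by
  simp [uniformPartition]

@[simp]
theorem uniformPartition_last (m : ℕ) : uniformPartition a b m (m + 1) = b := by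
  have : (m + 1 : ℝ) ≠ 0 := by positivity
  simp only [uniformPartition, Nat.cast_add, Nat.cast_one]
  field_simp
  ring

theorem uniformPartition_succ_sub (m i : ℕ) :
    uniformPartition a b m (i + 1) - uniformPartition a b m i = (b - a) / (m + 1) := by
  simp only [uniformPartition, Nat.cast_add, Nat.cast_one]
  ring

theorem lintegral_uniformPartition (hab : a ≤ b) (m : ℕ) (f : ℝ → ℝ≥0∞) :
    ∫⁻ s in Set.Ioc a b, f s = ∑ i ∈ Finset.range (m + 1),
      ∫⁻ s in Set.Ioc (uniformPartition a b m i) (uniformPartition a b m (i + 1)), f s := by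
  have h := lintegral_Ioc_eq_sum (uniformPartition_mono hab m) (m + 1) f
  rwa [uniformPartition_zero, uniformPartition_last] at h

/-- The averages of a function over the intervals of the uniform partition. -/
noncomputable def blockAverage (a b : ℝ) (m : ℕ) (f : ℝ → ℝ) (i : ℕ) : ℝ :=
  ⨍ s in Set.Ioc (uniformPartition a b m i) (uniformPartition a b m (i + 1)), f s

theorem blockAverage_error_le (hab : a ≤ b) {f : ℝ → ℝ}
    (hf : MemLp f 2 (volume.restrict (Set.Ioc a b))) (m : ℕ) (c : ℕ → ℝ) :
    ∑ i ∈ Finset.range (m + 1),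
      ∫⁻ s in Set.Ioc (uniformPartition a b m i) (uniformPartition a b m (i + 1)),
        ENNReal.ofReal ((blockAverage a b m f i - f s) ^ 2) ≤
    ∑ i ∈ Finset.range (m + 1),
      ∫⁻ s in Set.Ioc (uniformPartition a b m i) (uniformPartition a b m (i + 1)),
        ENNReal.ofReal ((c i - f s) ^ 2) := by
  refine Finset.sum_le_sum fun i hi => ?_
  rw [lintegral_sq_const_sub (hf.mono_measure ?_) (c i)]
  · exact le_self_add
  refine Measure.restrict_mono (Set.Ioc_subset_Ioc ?_ ?_) le_rfl
  · exact (uniformPartition_zero m).symm.trans_le (uniformPartition_mono hab m (Nat.zero_le i))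
  · exact (uniformPartition_mono hab m (Finset.mem_range.1 hi)).trans_eq (uniformPartition_last m)

theorem tendsto_blockAverage_error (hab : a ≤ b) {f : ℝ → ℝ}
    (hf : MemLp f 2 (volume.restrict (Set.Ioc a b))) :
    Tendsto (fun m : ℕ => ∑ i ∈ Finset.range (m + 1),
      ∫⁻ s in Set.Ioc (uniformPartition a b m i) (uniformPartition a b m (i + 1)),
        ENNReal.ofReal ((blockAverage a b m f i - f s) ^ 2)) atTop (𝓝 0) := by
  rw [ENNReal.tendsto_nhds_zero]
  intro η hη
  obtain ⟨ε, hε, hεη⟩ : ∃ ε : ℝ, 0 < ε ∧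
      2 * ENNReal.ofReal ε ^ 2 + ENNReal.ofReal (2 * ε ^ 2) * ENNReal.ofReal (b - a) ≤ η := by
    have h1 : Tendsto (fun ε : ℝ => 2 * ENNReal.ofReal ε ^ 2 +
        ENNReal.ofReal (2 * ε ^ 2) * ENNReal.ofReal (b - a)) (𝓝[>] 0) (𝓝 0) := by
      have h2 : Continuous fun ε : ℝ => 2 * ENNReal.ofReal ε ^ 2 +
          ENNReal.ofReal (2 * ε ^ 2) * ENNReal.ofReal (b - a) := by
        have h4 : Continuous fun ε : ℝ => ENNReal.ofReal (2 * ε ^ 2) :=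
          ENNReal.continuous_ofReal.comp (by fun_prop)
        exact ((ENNReal.continuous_const_mul ENNReal.ofNat_ne_top).comp
          ((ENNReal.continuous_pow 2).comp ENNReal.continuous_ofReal)).add
          ((ENNReal.continuous_mul_const ENNReal.ofReal_ne_top).comp h4)
      have h3 := h2.tendsto 0
      simp only [ENNReal.ofReal_zero, ne_eq, OfNat.ofNat_ne_zero, not_false_eq_true, zero_pow,
        mul_zero, zero_mul, add_zero] at h3
      exact h3.mono_left nhdsWithin_le_nhds
    obtain ⟨ε, h, h'⟩ := ((ENNReal.tendsto_nhds_zero.1 h1 η hη).and self_mem_nhdsWithin).exists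
    exact ⟨ε, h', h⟩
  obtain ⟨g, hg, hgL⟩ := hf.exists_boundedContinuous_eLpNorm_sub_le (by simp)
    (ENNReal.ofReal_pos.2 hε).ne'
  obtain ⟨δ, hδ, hgδ⟩ := Metric.uniformContinuousOn_iff.1
    (isCompact_Icc.uniformContinuousOn_of_continuous (f := (g : ℝ → ℝ)) (s := Set.Icc a b)
      g.continuous.continuousOn)
    ε hε
  have hfg : ∫⁻ s in Set.Ioc a b, ENNReal.ofReal ((g s - f s) ^ 2) ≤ ENNReal.ofReal ε ^ 2 := by
    have h := pow_le_pow_left' hg 2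
    rw [← lintegral_enorm_sq] at h
    refine le_trans (le_of_eq (lintegral_congr fun s => ?_)) h
    rw [← ofReal_norm, ← ENNReal.ofReal_pow (norm_nonneg _), Real.norm_eq_abs, sq_abs,
      ← neg_sub, neg_sq]
    rfl
  have hlim : Tendsto (fun m : ℕ => (b - a) / ((m : ℝ) + 1)) atTop (𝓝 0) := by
    have h := (tendsto_one_div_add_atTop_nhds_zero_nat (𝕜 := ℝ)).const_mul (b - a)
    simpa [div_eq_mul_inv] using h
  filter_upwards [hlim.eventually (gt_mem_nhds hδ)] with m hm
  refine (blockAverage_error_le hab hf m fun i => g (uniformPartition a b m (i + 1))).trans ?_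
  have hmono := uniformPartition_mono hab m
  have h1 : ∀ i ∈ Finset.range (m + 1),
      ∫⁻ s in Set.Ioc (uniformPartition a b m i) (uniformPartition a b m (i + 1)),
        ENNReal.ofReal ((g (uniformPartition a b m (i + 1)) - f s) ^ 2) ≤
      ∫⁻ s in Set.Ioc (uniformPartition a b m i) (uniformPartition a b m (i + 1)),
        (2 * ENNReal.ofReal ((g s - f s) ^ 2) + ENNReal.ofReal (2 * ε ^ 2)) := by
    intro i hi
    refine setLIntegral_mono' measurableSet_Ioc fun s hs => ?_
    have h0 : a ≤ uniformPartition a b m i :=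
      (uniformPartition_zero m).symm.trans_le (hmono (Nat.zero_le i))
    have h0' : uniformPartition a b m (i + 1) ≤ b :=
      (hmono (Finset.mem_range.1 hi)).trans_eq (uniformPartition_last m)
    have h2 := hgδ _ ⟨h0.trans (hmono (Nat.le_succ i)), h0'⟩ s
      ⟨h0.trans hs.1.le, hs.2.trans h0'⟩ (by
      rw [Real.dist_eq, abs_of_nonneg (sub_nonneg.2 hs.2)]
      have := uniformPartition_succ_sub (a := a) (b := b) m i
      linarith [hs.1])
    rw [Real.dist_eq] at h2
    have h3 := sq_lt_sq' (neg_lt_of_abs_lt h2) (lt_of_abs_lt h2)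
    rw [show (2 : ℝ≥0∞) = ENNReal.ofReal 2 by simp, ← ENNReal.ofReal_mul zero_le_two,
      ← ENNReal.ofReal_add (by positivity) (by positivity)]
    refine ENNReal.ofReal_le_ofReal ?_
    nlinarith [sq_nonneg ((g (uniformPartition a b m (i + 1)) - g s) - (g s - f s))]
  refine (Finset.sum_le_sum h1).trans ?_
  rw [← lintegral_uniformPartition hab, lintegral_add_right _ measurable_const,
    lintegral_const_mul' _ _ (by simp), lintegral_const, Measure.restrict_apply_univ,
    Real.volume_Ioc]
  exact (add_le_add_left (mul_le_mul_right hfg 2) _).trans hεη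

end uniformPartition

theorem measurable_setIntegral_prod {Ω : Type*} [MeasurableSpace Ω] {f : ℝ × Ω → ℝ}
    (hf : Measurable f) (s : Set ℝ) : Measurable fun ω => ∫ x in s, f (x, ω) :=
  (hf.stronglyMeasurable.integral_prod_left' (μ := volume.restrict s)).measurable

theorem measurable_setLIntegral_frobeniusSq {Ω : Type*} [MeasurableSpace Ω] {n d : ℕ}
    {H : ℝ → Ω → Matrix (Fin n) (Fin d) ℝ}
    (hH : ∀ p q, Measurable fun z : ℝ × Ω => H z.1 z.2 p q) (s : Set ℝ) :
    Measurable fun ω => ∫⁻ x in s, ENNReal.ofReal (frobeniusSq (H x ω)) :=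
  Measurable.lintegral_prod_left' (f := fun z : ℝ × Ω => ENNReal.ofReal (frobeniusSq (H z.1 z.2)))
    (measurable_frobeniusSq_of_entries hH).ennreal_ofReal

section averageProcess

variable {Ω : Type*} {mΩ : MeasurableSpace Ω} {F : Filtration ℝ mΩ} {n d : ℕ} {a b : ℝ}
  {H : ℝ → Ω → Matrix (Fin n) (Fin d) ℝ}

/-- The step process of the averages of an `F a`-measurable process over the intervals of the
uniform partition. -/
noncomputable def averageProcess (hab : a ≤ b) (hH : ∀ p q, @Measurable (ℝ × Ω) ℝ
    (MeasurableSpace.prod inferInstance (F a)) inferInstance (fun z => H z.1 z.2 p q)) (m : ℕ) :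
    StepProcess F n d a b where
  N := m + 1
  t := uniformPartition a b m
  mono := uniformPartition_mono hab m
  t_zero := uniformPartition_zero m
  t_last := uniformPartition_last m
  ξ i ω := Matrix.of fun p q => blockAverage a b m (fun s => H s ω p q) i
  meas i p q := by
    have h : Measurable[F a] fun ω => blockAverage a b m (fun s => H s ω p q) i := by
      simp only [blockAverage, setAverage_eq, smul_eq_mul]
      exact (@measurable_setIntegral_prod Ω (F a) _ (hH p q) _).const_mul _
    refine h.mono (F.mono ?_) le_rfl
    exact (uniformPartition_zero m).symm.trans_le (uniformPartition_mono hab m (Nat.zero_le i))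

variable (hab : a ≤ b) (hH : ∀ p q, @Measurable (ℝ × Ω) ℝ
  (MeasurableSpace.prod inferInstance (F a)) inferInstance (fun z => H z.1 z.2 p q))

theorem measurable_section (hH : ∀ p q, @Measurable (ℝ × Ω) ℝ
    (MeasurableSpace.prod inferInstance (F a)) inferInstance (fun z => H z.1 z.2 p q)) (ω : Ω)
    (p : Fin n) (q : Fin d) : Measurable fun s => H s ω p q :=
  (hH p q).comp (@measurable_prodMk_right _ _ _ (F a) ω)

theorem lintegral_averageProcess_sub (m : ℕ) (ω : Ω) :
    ∫⁻ s in Set.Ioc a b, ENNReal.ofReal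
      (frobeniusSq ((averageProcess hab hH m).value s ω - H s ω)) =
    ∑ p, ∑ q, ∑ i ∈ Finset.range (m + 1),
      ∫⁻ s in Set.Ioc (uniformPartition a b m i) (uniformPartition a b m (i + 1)),
        ENNReal.ofReal ((blockAverage a b m (fun s => H s ω p q) i - H s ω p q) ^ 2) := by
  rw [lintegral_uniformPartition hab m]
  have h : ∀ i ∈ Finset.range (m + 1),
      ∫⁻ s in Set.Ioc (uniformPartition a b m i) (uniformPartition a b m (i + 1)),
        ENNReal.ofReal (frobeniusSq ((averageProcess hab hH m).value s ω - H s ω)) =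
      ∑ p, ∑ q, ∫⁻ s in Set.Ioc (uniformPartition a b m i) (uniformPartition a b m (i + 1)),
        ENNReal.ofReal ((blockAverage a b m (fun s => H s ω p q) i - H s ω p q) ^ 2) := by
    intro i hi
    have h1 : ∀ s ∈ Set.Ioc (uniformPartition a b m i) (uniformPartition a b m (i + 1)),
        ENNReal.ofReal (frobeniusSq ((averageProcess hab hH m).value s ω - H s ω)) =
        ENNReal.ofReal (frobeniusSq ((averageProcess hab hH m).ξ i ω - H s ω)) := fun s hs => by
      rw [(averageProcess hab hH m).value_eq (Finset.mem_range.1 hi) hs]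
    rw [setLIntegral_congr_fun measurableSet_Ioc h1, lintegral_frobeniusSq]
    · rfl
    · exact fun p q => measurable_const.sub (measurable_section hH ω p q)
  rw [Finset.sum_congr rfl h, Finset.sum_comm]
  exact Finset.sum_congr rfl fun p _ => Finset.sum_comm

theorem lintegral_averageProcess_sub_add_energy (m : ℕ) {ω : Ω}
    (h : ∫⁻ s in Set.Ioc a b, ENNReal.ofReal (frobeniusSq (H s ω)) < ∞) :
    (∫⁻ s in Set.Ioc a b, ENNReal.ofReal
      (frobeniusSq ((averageProcess hab hH m).value s ω - H s ω))) +
      ENNReal.ofReal ((averageProcess hab hH m).energy ω) =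
    ∫⁻ s in Set.Ioc a b, ENNReal.ofReal (frobeniusSq (H s ω)) := by
  have hL := memLp_entry (measurable_section hH ω) h
  have hmono := uniformPartition_mono hab m
  have h0 : ∀ i, 0 ≤ uniformPartition a b m (i + 1) - uniformPartition a b m i :=
    fun i => sub_nonneg.2 (hmono (Nat.le_succ i))
  have henergy : ENNReal.ofReal ((averageProcess hab hH m).energy ω) =
      ∑ p, ∑ q, ∑ i ∈ Finset.range (m + 1),
        ENNReal.ofReal (blockAverage a b m (fun s => H s ω p q) i ^ 2) *
        ENNReal.ofReal (uniformPartition a b m (i + 1) - uniformPartition a b m i) := by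
    refine (ENNReal.ofReal_sum_of_nonneg fun i _ =>
      mul_nonneg (frobeniusSq_nonneg _) (h0 i)).trans ?_
    simp only [ENNReal.ofReal_mul (frobeniusSq_nonneg _), ofReal_frobeniusSq, Finset.sum_mul]
    rw [Finset.sum_comm]
    exact Finset.sum_congr rfl fun p _ => Finset.sum_comm
  refine (congrArg₂ (· + ·) (lintegral_averageProcess_sub hab hH m ω) henergy).trans ?_
  rw [lintegral_frobeniusSq (measurable_section hH ω), ← Finset.sum_add_distrib]
  refine Finset.sum_congr rfl fun p _ => ?_
  rw [← Finset.sum_add_distrib]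
  refine Finset.sum_congr rfl fun q _ => ?_
  rw [← Finset.sum_add_distrib, lintegral_uniformPartition hab m]
  refine Finset.sum_congr rfl fun i hi => ?_
  have h1 : Set.Ioc (uniformPartition a b m i) (uniformPartition a b m (i + 1)) ⊆
      Set.Ioc a b := Set.Ioc_subset_Ioc
    ((uniformPartition_zero m).symm.trans_le (hmono (Nat.zero_le i)))
    ((hmono (Finset.mem_range.1 hi)).trans_eq (uniformPartition_last m))
  have h2 := lintegral_sq_const_sub
    ((hL p q).mono_measure (Measure.restrict_mono h1 le_rfl)) 0
  simp only [zero_sub, neg_sq, Measure.restrict_apply_univ, Real.volume_Ioc] at h2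
  rw [h2]
  rfl

theorem tendsto_lintegral_averageProcess_sub {ω : Ω}
    (h : ∫⁻ s in Set.Ioc a b, ENNReal.ofReal (frobeniusSq (H s ω)) < ∞) :
    Tendsto (fun m => ∫⁻ s in Set.Ioc a b, ENNReal.ofReal
      (frobeniusSq ((averageProcess hab hH m).value s ω - H s ω))) atTop (𝓝 0) := by
  have hL := memLp_entry (measurable_section hH ω) h
  simp only [lintegral_averageProcess_sub]
  rw [← Finset.sum_const_zero (s := (Finset.univ : Finset (Fin n)))]
  refine tendsto_finsetSum _ fun p _ => ?_
  rw [← Finset.sum_const_zero (s := (Finset.univ : Finset (Fin d)))]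
  exact tendsto_finsetSum _ fun q _ => tendsto_blockAverage_error hab (hL p q)

end averageProcess

section secondMoment

variable {Ω : Type*} {mΩ : MeasurableSpace Ω} {P : Measure Ω} {F : Filtration ℝ mΩ} {n d : ℕ}
  {a b T : ℝ} {w : ℝ → Ω → EuclideanSpace ℝ (Fin d)} {H : ℝ → Ω → Matrix (Fin n) (Fin d) ℝ}

theorem StepProcess.measurable_uncurry_value (S : StepProcess F n d a b) (p : Fin n) (q : Fin d) :
    Measurable fun z : ℝ × Ω => S.value z.1 z.2 p q := by
  simp only [value, Matrix.sum_apply]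
  refine Finset.measurable_sum _ fun i _ => ?_
  have h : (fun z : ℝ × Ω => (Set.Ioc (S.t i) (S.t (i + 1))).indicator (fun _ => S.ξ i z.2) z.1 p q)
      = (Prod.fst ⁻¹' Set.Ioc (S.t i) (S.t (i + 1))).indicator fun z => S.ξ i z.2 p q := by
    ext z
    by_cases hz : z.1 ∈ Set.Ioc (S.t i) (S.t (i + 1))
    · rw [Set.indicator_of_mem hz, Set.indicator_of_mem (Set.mem_preimage.2 hz)]
    · rw [Set.indicator_of_notMem hz, Set.indicator_of_notMem (fun h => hz (Set.mem_preimage.1 h))]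
      rfl
  rw [h]
  exact (((S.meas i p q).mono (F.le _) le_rfl).comp measurable_snd).indicator
    (measurable_fst measurableSet_Ioc)

theorem measurable_of_filtration {s : ℝ} {f : ℝ × Ω → ℝ} (hf : @Measurable (ℝ × Ω) ℝ
    (MeasurableSpace.prod inferInstance (F s)) inferInstance f) : Measurable f :=
  hf.mono (sup_le_sup le_rfl (MeasurableSpace.comap_mono (F.le s))) le_rfl

variable (hab : a ≤ b) (hH : ∀ p q, @Measurable (ℝ × Ω) ℝ
  (MeasurableSpace.prod inferInstance (F a)) inferInstance (fun z => H z.1 z.2 p q))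

theorem measurable_lintegral_averageProcess_sub (m : ℕ) : Measurable fun ω =>
    ∫⁻ s in Set.Ioc a b, ENNReal.ofReal
      (frobeniusSq ((averageProcess hab hH m).value s ω - H s ω)) :=
  measurable_setLIntegral_frobeniusSq (H := fun s ω => (averageProcess hab hH m).value s ω - H s ω)
    (fun p q => ((averageProcess hab hH m).measurable_uncurry_value p q).sub
      (measurable_of_filtration (hH p q))) _

theorem measurable_lintegral_integrand (hH : ∀ p q, @Measurable (ℝ × Ω) ℝ
    (MeasurableSpace.prod inferInstance (F a)) inferInstance (fun z => H z.1 z.2 p q)) :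
    Measurable[F a] fun ω => ∫⁻ s in Set.Ioc a b, ENNReal.ofReal (frobeniusSq (H s ω)) :=
  @measurable_setLIntegral_frobeniusSq Ω (F a) n d H hH _

theorem tendsto_lintegral_lintegral_averageProcess_sub
    (hV : ∫⁻ ω, (∫⁻ s in Set.Ioc a b, ENNReal.ofReal (frobeniusSq (H s ω))) ∂P ≠ ∞) :
    Tendsto (fun m => ∫⁻ ω, (∫⁻ s in Set.Ioc a b, ENNReal.ofReal
      (frobeniusSq ((averageProcess hab hH m).value s ω - H s ω))) ∂P) atTop (𝓝 0) := by
  have hVm := (measurable_lintegral_integrand (b := b) hH).mono (F.le a) le_rfl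
  have hfin := ae_lt_top hVm hV
  rw [← lintegral_zero (μ := P)]
  refine tendsto_lintegral_of_dominated_convergence _
    (measurable_lintegral_averageProcess_sub hab hH) (fun m => ?_) hV ?_
  · filter_upwards [hfin] with ω hω
    exact le_self_add.trans_eq (lintegral_averageProcess_sub_add_energy hab hH m hω)
  · filter_upwards [hfin] with ω hω
    exact tendsto_lintegral_averageProcess_sub hab hH hω

/-- The elementary integrals of the averages of an integrand that is square-integrable in time and
outcome converge in mean square, and the limit satisfies the Itô isometry. -/
theorem exists_tendsto_eLpNorm_integral_averageProcess (hw : IsBrownianMotionOn P F T w)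
    (ha : 0 ≤ a) (hb : b ≤ T)
    (hV : ∫⁻ ω, (∫⁻ s in Set.Ioc a b, ENNReal.ofReal (frobeniusSq (H s ω))) ∂P ≠ ∞) :
    ∃ I : Ω → EuclideanSpace ℝ (Fin n), AEStronglyMeasurable I P ∧
      Tendsto (fun m => eLpNorm ((averageProcess hab hH m).integral w - I) 2 P) atTop (𝓝 0) ∧
      ∫⁻ ω, ‖I ω‖ₑ ^ 2 ∂P =
        ∫⁻ ω, (∫⁻ s in Set.Ioc a b, ENNReal.ofReal (frobeniusSq (H s ω))) ∂P := by
  have hVm := (measurable_lintegral_integrand (b := b) hH).mono (F.le a) le_rfl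
  have hfin := ae_lt_top hVm hV
  have hD := tendsto_lintegral_lintegral_averageProcess_sub hab hH hV
  have hDm := measurable_lintegral_averageProcess_sub hab hH
  set S := averageProcess hab hH
  set D : ℕ → Ω → ℝ≥0∞ := fun m ω =>
    ∫⁻ s in Set.Ioc a b, ENNReal.ofReal (frobeniusSq ((S m).value s ω - H s ω))
  set V : Ω → ℝ≥0∞ := fun ω => ∫⁻ s in Set.Ioc a b, ENNReal.ofReal (frobeniusSq (H s ω))
  have hDV : ∀ m, ∀ᵐ ω ∂P, D m ω + ENNReal.ofReal ((S m).energy ω) = V ω := fun m => by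
    filter_upwards [hfin] with ω hω
    exact lintegral_averageProcess_sub_add_energy hab hH m hω
  have hDV' : ∀ m, ∫⁻ ω, D m ω ∂P + ∫⁻ ω, ENNReal.ofReal ((S m).energy ω) ∂P = ∫⁻ ω, V ω ∂P :=
    fun m => by rw [← lintegral_add_left (hDm m), lintegral_congr_ae (hDV m)]
  have hDfin : ∀ m, ∫⁻ ω, D m ω ∂P ≠ ∞ := fun m =>
    ((le_self_add.trans_eq (hDV' m)).trans_lt (lt_top_iff_ne_top.2 hV)).ne
  have hEfin : ∀ m, ∫⁻ ω, ENNReal.ofReal ((S m).energy ω) ∂P ≠ ∞ := fun m =>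
    ((le_add_self.trans_eq (hDV' m)).trans_lt (lt_top_iff_ne_top.2 hV)).ne
  have hXm : ∀ m, AEStronglyMeasurable ((S m).integral w) P := fun m =>
    ((S m).measurable_integral hw ha hb).aestronglyMeasurable
  have hX2 : ∀ m, eLpNorm ((S m).integral w) 2 P ^ 2 = ∫⁻ ω, ENNReal.ofReal ((S m).energy ω) ∂P :=
    fun m => by rw [← lintegral_enorm_sq, (S m).lintegral_integral_sq hw ha hb (hEfin m)]
  have hXL : ∀ m, MemLp ((S m).integral w) 2 P := fun m => by
    refine ⟨hXm m, lt_top_iff_ne_top.2 fun h => hEfin m ?_⟩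
    rw [← hX2, h]
    simp
  have hsub : ∀ m l, eLpNorm ((S m).integral w - (S l).integral w) 2 P ^ 2 ≤
      2 * ∫⁻ ω, D m ω ∂P + 2 * ∫⁻ ω, D l ω ∂P := by
    intro m l
    obtain ⟨R, hR, hRI⟩ := (S m).exists_sub (S l)
    have h1 : (S m).integral w - (S l).integral w = R.integral w := by
      ext1 ω
      exact (hRI w ω).symm
    have h2 : ∫⁻ ω, ENNReal.ofReal (R.energy ω) ∂P ≤
        2 * ∫⁻ ω, D m ω ∂P + 2 * ∫⁻ ω, D l ω ∂P := by
      rw [← lintegral_const_mul _ (hDm m), ← lintegral_const_mul _ (hDm l),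
        ← lintegral_add_left ((hDm m).const_mul 2)]
      exact lintegral_mono fun ω =>
        R.energy_le (fun p q => (measurable_section hH ω p q).aemeasurable) hR
    have h3 : ∫⁻ ω, ENNReal.ofReal (R.energy ω) ∂P ≠ ∞ := by
      refine (h2.trans_lt (lt_top_iff_ne_top.2 ?_)).ne
      exact ENNReal.add_ne_top.2 ⟨ENNReal.mul_ne_top (by simp) (hDfin m),
        ENNReal.mul_ne_top (by simp) (hDfin l)⟩
    rw [h1, ← lintegral_enorm_sq, R.lintegral_integral_sq hw ha hb h3]
    exact h2
  have hcauchy : CauchySeq fun m => (hXL m).toLp := by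
    rw [EMetric.cauchySeq_iff]
    intro ε hε
    have h2D := ENNReal.Tendsto.const_mul (a := 2) hD (Or.inr (by simp))
    rw [mul_zero] at h2D
    have hε2 : 0 < ε ^ 2 / 2 := ENNReal.half_pos (pow_ne_zero _ hε.ne')
    obtain ⟨N, hN⟩ := eventually_atTop.1 (h2D.eventually (gt_mem_nhds hε2))
    refine ⟨N, fun m hm l hl => ?_⟩
    rw [Lp.edist_toLp_toLp]
    by_contra h
    have h1 := (pow_le_pow_left' (not_lt.1 h) 2).trans (hsub m l)
    have h2 := ENNReal.add_lt_add (hN m hm) (hN l hl)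
    rw [ENNReal.add_halves] at h2
    exact absurd h1 (not_le.2 h2)
  obtain ⟨J, hJ⟩ := cauchySeq_tendsto_of_complete hcauchy
  have hJ2 : Tendsto (fun m => eLpNorm
      ((S m).integral w - (J : Ω → EuclideanSpace ℝ (Fin n))) 2 P) atTop (𝓝 0) := by
    have h := (Lp.tendsto_Lp_iff_tendsto_eLpNorm' _ _).1 hJ
    refine h.congr fun m => eLpNorm_congr_ae ?_
    filter_upwards [(hXL m).coeFn_toLp] with ω hω
    simp [hω]
  refine ⟨J, Lp.aestronglyMeasurable J, hJ2, ?_⟩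
  have h1 : Tendsto (fun m => eLpNorm ((S m).integral w) 2 P) atTop (𝓝 (eLpNorm J 2 P)) := by
    have h := (continuous_enorm.tendsto J).comp hJ
    simp only [Lp.enorm_def] at h
    refine h.congr fun m => ?_
    simp only [Function.comp_apply]
    exact eLpNorm_congr_ae (hXL m).coeFn_toLp
  have h2 := hD.add (((ENNReal.continuous_pow 2).tendsto _).comp h1)
  simp only [zero_add, Function.comp_def, hX2] at h2
  rw [lintegral_enorm_sq]
  exact tendsto_nhds_unique h2 (tendsto_const_nhds.congr fun m => (hDV' m).symm)

/-- Averages of an integrand multiplied by a random variable that is known at the beginning. -/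
theorem integral_averageProcess_smul {c : Ω → ℝ}
    (hcH : ∀ p q, @Measurable (ℝ × Ω) ℝ (MeasurableSpace.prod inferInstance (F a)) inferInstance
      (fun z => (c z.2 • H z.1 z.2) p q)) (m : ℕ) (ω : Ω) :
    (averageProcess (H := fun s ω => c ω • H s ω) hab hcH m).integral w ω =
      c ω • (averageProcess hab hH m).integral w ω := by
  have h : ∀ i, (averageProcess (H := fun s ω => c ω • H s ω) hab hcH m).ξ i ω =
      c ω • (averageProcess hab hH m).ξ i ω := by
    intro i
    ext p q
    simp only [averageProcess, Matrix.of_apply, Matrix.smul_apply, smul_eq_mul, blockAverage,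
      setAverage_eq]
    rw [integral_const_mul, mul_left_comm]
  simp only [StepProcess.integral, h, Finset.smul_sum, map_smul, LinearMap.smul_apply]
  rfl

theorem measurable_smul_integrand {c : Ω → ℝ} (hc : Measurable[F a] c)
    (hH : ∀ p q, @Measurable (ℝ × Ω) ℝ
      (MeasurableSpace.prod inferInstance (F a)) inferInstance (fun z => H z.1 z.2 p q))
    (p : Fin n) (q : Fin d) : @Measurable (ℝ × Ω) ℝ (MeasurableSpace.prod inferInstance (F a))
      inferInstance (fun z => (c z.2 • H z.1 z.2) p q) :=
  @Measurable.mul _ _ _ _ _ (_) _ _ (hc.comp (@measurable_snd _ _ _ (F a))) (hH p q)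

theorem lintegral_smul_integrand (c : Ω → ℝ) (ω : Ω) :
    ∫⁻ s in Set.Ioc a b, ENNReal.ofReal (frobeniusSq (c ω • H s ω)) =
      ENNReal.ofReal (c ω ^ 2) * ∫⁻ s in Set.Ioc a b, ENNReal.ofReal (frobeniusSq (H s ω)) := by
  rw [← lintegral_const_mul' _ _ (by simp)]
  simp only [frobeniusSq_smul, ENNReal.ofReal_mul (sq_nonneg _)]

/-- A subsequence of the elementary integrals of the averages converges almost surely. -/
theorem exists_ae_tendsto_integral_averageProcess [IsProbabilityMeasure P]
    (hw : IsBrownianMotionOn P F T w) (ha : 0 ≤ a) (hb : b ≤ T)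
    (hV : ∀ᵐ ω ∂P, ∫⁻ s in Set.Ioc a b, ENNReal.ofReal (frobeniusSq (H s ω)) < ∞) :
    ∃ (I : Ω → EuclideanSpace ℝ (Fin n)) (k : ℕ → ℕ), StrictMono k ∧
      ∀ᵐ ω ∂P, Tendsto (fun j => (averageProcess hab hH (k j)).integral w ω) atTop (𝓝 (I ω)) := by
  have hVm := measurable_lintegral_integrand (b := b) hH
  set V : Ω → ℝ≥0∞ := fun ω => ∫⁻ s in Set.Ioc a b, ENNReal.ofReal (frobeniusSq (H s ω))
  let c : Ω → ℝ := fun ω => (√(1 + (V ω).toReal))⁻¹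
  have hc : Measurable[F a] c :=
    @Measurable.inv _ _ _ _ _ (_) _ (@Measurable.sqrt _ (_) _
      (@Measurable.const_add _ _ _ _ _ (_) _ (@Measurable.ennreal_toReal _ (_) _ hVm) 1))
  have hc0 : ∀ ω, c ω ≠ 0 := fun ω => by positivity
  have hcV : ∫⁻ ω, (∫⁻ s in Set.Ioc a b, ENNReal.ofReal (frobeniusSq (c ω • H s ω))) ∂P ≠ ∞ := by
    have h : ∫⁻ ω, (∫⁻ s in Set.Ioc a b, ENNReal.ofReal (frobeniusSq (c ω • H s ω))) ∂P ≤
        ∫⁻ _, 1 ∂P := by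
      refine lintegral_mono_ae ?_
      filter_upwards [hV] with ω hω
      rw [lintegral_smul_integrand]
      change V ω < ∞ at hω
      change ENNReal.ofReal (c ω ^ 2) * V ω ≤ 1
      rw [← ENNReal.ofReal_toReal (a := V ω) hω.ne, ← ENNReal.ofReal_mul (sq_nonneg _),
        ← ENNReal.ofReal_one]
      refine ENNReal.ofReal_le_ofReal ?_
      have h0 : 0 ≤ (V ω).toReal := ENNReal.toReal_nonneg
      rw [inv_pow, Real.sq_sqrt (by positivity), inv_mul_eq_div, div_le_one (by positivity)]
      linarith
    exact (h.trans_lt (by simp)).ne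
  obtain ⟨I, hI, hlim, -⟩ := exists_tendsto_eLpNorm_integral_averageProcess
    (H := fun s ω => c ω • H s ω) hab (measurable_smul_integrand hc hH) hw ha hb hcV
  obtain ⟨k, hk, hkI⟩ := (tendstoInMeasure_of_tendsto_eLpNorm two_ne_zero (fun m =>
    (StepProcess.measurable_integral _ hw ha hb).aestronglyMeasurable) hI
      hlim).exists_seq_tendsto_ae
  refine ⟨fun ω => (c ω)⁻¹ • I ω, k, hk, ?_⟩
  filter_upwards [hkI] with ω hω
  refine (hω.const_smul (c ω)⁻¹).congr fun j => ?_
  rw [integral_averageProcess_smul hab hH, smul_smul, inv_mul_cancel₀ (hc0 ω), one_smul]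

/-- The Itô integral of an integrand that is known at the beginning exists. -/
theorem isItoIntegral_of_ae_tendsto [IsProbabilityMeasure P]
    (hw : IsBrownianMotionOn P F T w) (ha : 0 ≤ a) (hb : b ≤ T)
    (hV : ∀ᵐ ω ∂P, ∫⁻ s in Set.Ioc a b, ENNReal.ofReal (frobeniusSq (H s ω)) < ∞)
    {I : Ω → EuclideanSpace ℝ (Fin n)} {k : ℕ → ℕ} (hk : StrictMono k)
    (hI : ∀ᵐ ω ∂P, Tendsto (fun j => (averageProcess hab hH (k j)).integral w ω) atTop (𝓝 (I ω))) :
    IsItoIntegral P F w a b H I := by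
  refine ⟨fun j => averageProcess hab hH (k j), fun ε hε => ?_,
    tendstoInMeasure_of_tendsto_ae (fun j =>
      (StepProcess.measurable_integral _ hw ha hb).aestronglyMeasurable) hI⟩
  have hDm := fun j => measurable_lintegral_averageProcess_sub hab hH (k j)
  rw [← measure_empty (μ := P)]
  refine tendsto_measure_of_ae_tendsto_indicator_of_isFiniteMeasure atTop MeasurableSet.empty
    (fun j => measurableSet_le measurable_const (hDm j)) ?_
  filter_upwards [hV] with ω hω
  have h := (tendsto_lintegral_averageProcess_sub hab hH hω).comp hk.tendsto_atTop
  filter_upwards [h.eventually (gt_mem_nhds hε)] with j hj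
  simpa using hj

/-- The conditional Itô isometry, in integrated form. -/
theorem lintegral_smul_sq_of_ae_tendsto [IsProbabilityMeasure P]
    (hw : IsBrownianMotionOn P F T w) (ha : 0 ≤ a) (hb : b ≤ T)
    {I : Ω → EuclideanSpace ℝ (Fin n)} {k : ℕ → ℕ} (hk : StrictMono k)
    (hI : ∀ᵐ ω ∂P, Tendsto (fun j => (averageProcess hab hH (k j)).integral w ω) atTop (𝓝 (I ω)))
    {c : Ω → ℝ} (hc : Measurable[F a] c)
    (hcV : ∫⁻ ω, ENNReal.ofReal (c ω ^ 2) *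
      (∫⁻ s in Set.Ioc a b, ENNReal.ofReal (frobeniusSq (H s ω))) ∂P ≠ ∞) :
    ∫⁻ ω, ‖c ω • I ω‖ₑ ^ 2 ∂P = ∫⁻ ω, ENNReal.ofReal (c ω ^ 2) *
      (∫⁻ s in Set.Ioc a b, ENNReal.ofReal (frobeniusSq (H s ω))) ∂P := by
  simp only [← lintegral_smul_integrand] at hcV ⊢
  obtain ⟨J, hJ, hlim, hJ2⟩ := exists_tendsto_eLpNorm_integral_averageProcess
    (H := fun s ω => c ω • H s ω) hab (measurable_smul_integrand hc hH) hw ha hb hcV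
  rw [← hJ2]
  obtain ⟨l, hl, hlJ⟩ := ((tendstoInMeasure_of_tendsto_eLpNorm two_ne_zero (fun m =>
    (StepProcess.measurable_integral _ hw ha hb).aestronglyMeasurable) hJ
      hlim).comp hk.tendsto_atTop).exists_seq_tendsto_ae
  refine lintegral_congr_ae ?_
  filter_upwards [hI, hlJ] with ω h1 h2
  have h3 := (h1.comp hl.tendsto_atTop).const_smul (c ω)
  rw [tendsto_nhds_unique h3 (h2.congr fun j => ?_)]
  simp only [Function.comp_apply]
  rw [integral_averageProcess_smul hab hH]

end secondMoment

section orthogonalProjection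

variable {Ω : Type*} {mΩ : MeasurableSpace Ω} {P : Measure Ω} {F : Filtration ℝ mΩ} {n d : ℕ}
  {a b T : ℝ} {w : ℝ → Ω → EuclideanSpace ℝ (Fin d)} {H : ℝ → Ω → Matrix (Fin n) (Fin d) ℝ}

/-- The conditional Itô isometry. -/
theorem condLExp_sq_of_ae_tendsto [IsProbabilityMeasure P] (hab : a ≤ b)
    (hH : ∀ p q, @Measurable (ℝ × Ω) ℝ
      (MeasurableSpace.prod inferInstance (F a)) inferInstance (fun z => H z.1 z.2 p q))
    (hw : IsBrownianMotionOn P F T w) (ha : 0 ≤ a) (hb : b ≤ T)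
    (hV : ∀ᵐ ω ∂P, ∫⁻ s in Set.Ioc a b, ENNReal.ofReal (frobeniusSq (H s ω)) < ∞)
    {I : Ω → EuclideanSpace ℝ (Fin n)} {k : ℕ → ℕ} (hk : StrictMono k)
    (hI : ∀ᵐ ω ∂P, Tendsto (fun j => (averageProcess hab hH (k j)).integral w ω) atTop (𝓝 (I ω))) :
    condLExp (F a) P (fun ω => ‖I ω‖ₑ ^ 2) =ᵐ[P]
      fun ω => ∫⁻ s in Set.Ioc a b, ENNReal.ofReal (frobeniusSq (H s ω)) := by
  have hVm := measurable_lintegral_integrand (b := b) hH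
  refine (ae_eq_condLExp (F.le a) P _ hVm fun B hB => ?_).symm
  have key := fun (c : Ω → ℝ) => lintegral_smul_sq_of_ae_tendsto hab hH hw ha hb hk hI (c := c)
  set V : Ω → ℝ≥0∞ := fun ω => ∫⁻ s in Set.Ioc a b, ENNReal.ofReal (frobeniusSq (H s ω))
  let E : ℕ → Set Ω := fun K => B ∩ {ω | ⌊(V ω).toReal⌋₊ = K}
  have hfl : Measurable[F a] fun ω => ⌊(V ω).toReal⌋₊ :=
    Nat.measurable_floor.comp (@Measurable.ennreal_toReal _ (_) _ hVm)
  have hE : ∀ K, MeasurableSet[F a] (E K) := fun K =>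
    @MeasurableSet.inter _ (_) _ _ hB (hfl (measurableSet_singleton K))
  have hBE : B = ⋃ K, E K := by
    ext ω
    simp [E]
  have hdisj : Pairwise (Function.onFun Disjoint E) := by
    intro K L hKL
    refine Set.disjoint_left.2 fun ω h1 h2 => hKL ?_
    exact h1.2.symm.trans h2.2
  rw [hBE, lintegral_iUnion (fun K => F.le a _ (hE K)) hdisj,
    lintegral_iUnion (fun K => F.le a _ (hE K)) hdisj]
  refine tsum_congr fun K => ?_
  have hind : ∀ f : Ω → ℝ≥0∞, (fun ω => ENNReal.ofReal ((E K).indicator 1 ω ^ 2) * f ω) =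
      (E K).indicator f := by
    intro f
    ext ω
    by_cases h : ω ∈ E K <;> simp [h]
  have hind2 : (fun ω => ‖(E K).indicator (1 : Ω → ℝ) ω • I ω‖ₑ ^ 2) =
      (E K).indicator fun ω => ‖I ω‖ₑ ^ 2 := by
    ext ω
    by_cases h : ω ∈ E K <;> simp [h]
  have hc : Measurable[F a] ((E K).indicator (1 : Ω → ℝ)) :=
    @Measurable.indicator _ _ (_) _ _ _ _ (@measurable_const _ _ _ (_) 1) (hE K)
  have h := key _ hc
  rw [hind2] at h
  change lintegral P (fun ω => ENNReal.ofReal ((E K).indicator 1 ω ^ 2) * V ω) ≠ ∞ →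
    _ = lintegral P (fun ω => ENNReal.ofReal ((E K).indicator 1 ω ^ 2) * V ω) at h
  rw [hind V, lintegral_indicator (F.le a _ (hE K)), lintegral_indicator (F.le a _ (hE K))] at h
  refine (h ?_).symm
  have hle : ∫⁻ ω in E K, V ω ∂P ≤ ∫⁻ ω in E K, ENNReal.ofReal (K + 1) ∂P := by
    refine setLIntegral_mono_ae' (F.le a _ (hE K)) ?_
    filter_upwards [hV] with ω hω hωE
    change V ω < ∞ at hω
    rw [← ENNReal.ofReal_toReal hω.ne]
    refine ENNReal.ofReal_le_ofReal ?_
    have h1 : ⌊(V ω).toReal⌋₊ = K := hωE.2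
    rw [← h1]
    exact (Nat.lt_floor_add_one _).le
  refine (hle.trans_lt ?_).ne
  rw [setLIntegral_const]
  exact ENNReal.mul_lt_top ENNReal.ofReal_lt_top (measure_lt_top _ _)

theorem isItoIntegral_itoIntegral {I : Ω → EuclideanSpace ℝ (Fin n)}
    (hI : IsItoIntegral P F w a b H I) : IsItoIntegral P F w a b H (itoIntegral P F w a b H) := by
  have h : ∃ I, IsItoIntegral P F w a b H I := ⟨I, hI⟩
  rw [itoIntegral, dif_pos h]
  exact h.choose_spec

/-- The step process that is constant in time. -/
def StepProcess.const (hab : a ≤ b) {G : Ω → Matrix (Fin n) (Fin d) ℝ}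
    (hG : MatrixMeasurable (F a) G) : StepProcess F n d a b where
  N := 1
  t i := if i = 0 then a else b
  mono := monotone_nat_of_le_succ fun i => by
    rw [if_neg (Nat.succ_ne_zero i)]
    split_ifs
    exacts [hab, le_rfl]
  t_zero := if_pos rfl
  t_last := if_neg one_ne_zero
  ξ _ := G
  meas i p q := (hG p q).mono (F.mono (by split_ifs; exacts [le_rfl, hab])) le_rfl

/-- The Itô integral of a difference with an integrand that is constant in time. -/
theorem IsItoIntegral.sub_const (hab : a ≤ b) {I : Ω → EuclideanSpace ℝ (Fin n)}
    (hI : IsItoIntegral P F w a b H I) {G : Ω → Matrix (Fin n) (Fin d) ℝ}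
    (hG : MatrixMeasurable (F a) G) :
    IsItoIntegral P F w a b (fun s ω => H s ω - G ω)
      (fun ω => I ω - Matrix.toEuclideanLin (G ω) (w b ω - w a ω)) := by
  obtain ⟨S, hS, hSI⟩ := hI
  let C : StepProcess F n d a b := StepProcess.const hab hG
  have hCI : ∀ ω, C.integral w ω = Matrix.toEuclideanLin (G ω) (w b ω - w a ω) := fun ω => by
    simp [C, StepProcess.const, StepProcess.integral]
  have hCv : ∀ s ∈ Set.Ioc a b, ∀ ω, C.value s ω = G ω := fun s hs ω =>
    C.value_eq (i := 0) Nat.zero_lt_one (by simpa [C, StepProcess.const] using hs) ω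
  choose R hR hRI using fun m => (S m).exists_sub C
  refine ⟨R, fun ε hε => ?_, fun ε hε => ?_⟩
  · refine (hS ε hε).congr fun m => ?_
    congr 1
    ext ω
    simp only [Set.mem_ofPred_eq]
    rw [setLIntegral_congr_fun measurableSet_Ioc]
    intro s hs
    simp only
    rw [hR m s hs, hCv s hs, sub_sub_sub_cancel_right]
  · refine (hSI ε hε).congr fun m => ?_
    simp only [hRI, hCI, edist_sub_right]

theorem lintegral_frobeniusSq_sub (hab : a < b) {f : ℝ → Matrix (Fin n) (Fin d) ℝ}
    (hf : ∀ p q, Measurable fun s => f s p q)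
    (hf2 : ∫⁻ s in Set.Ioc a b, ENNReal.ofReal (frobeniusSq (f s)) < ∞)
    (G : Matrix (Fin n) (Fin d) ℝ) {K : Matrix (Fin n) (Fin d) ℝ}
    (hK : ∀ p q, K p q = (1 / (b - a)) * ∫ s in a..b, f s p q) :
    ∫⁻ s in Set.Ioc a b, ENNReal.ofReal (frobeniusSq (f s - G)) =
      (∫⁻ s in Set.Ioc a b, ENNReal.ofReal (frobeniusSq (f s - K))) +
        ENNReal.ofReal (frobeniusSq (G - K)) * ENNReal.ofReal (b - a) := by
  have hL := memLp_entry hf hf2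
  have hK' : ∀ p q, ⨍ s in Set.Ioc a b, f s p q = K p q := fun p q => by
    rw [hK, setAverage_eq, intervalIntegral.integral_of_le hab.le, smul_eq_mul,
      Real.volume_real_Ioc_of_le hab.le, one_div]
  have hsub : ∀ M : Matrix (Fin n) (Fin d) ℝ, ∀ p q, Measurable fun s => (f s - M) p q :=
    fun M p q => (hf p q).sub_const (M p q)
  have h := fun p q => lintegral_sq_const_sub (hL p q) (G p q)
  simp only [hK', Measure.restrict_apply_univ, Real.volume_Ioc] at h
  refine (lintegral_frobeniusSq (hsub G)).trans ?_
  refine Eq.trans ?_ (congrArg (· + _) (lintegral_frobeniusSq (hsub K)).symm)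
  rw [ofReal_frobeniusSq, Finset.sum_mul, ← Finset.sum_add_distrib]
  refine Finset.sum_congr rfl fun p _ => ?_
  rw [Finset.sum_mul, ← Finset.sum_add_distrib]
  refine Finset.sum_congr rfl fun q _ => ?_
  have hc : ∀ M : Matrix (Fin n) (Fin d) ℝ, ∀ s, (f s - M) p q ^ 2 = (M p q - f s p q) ^ 2 :=
    fun M s => by rw [Matrix.sub_apply, ← neg_sub, neg_sq]
  simp only [hc]
  exact h p q

theorem measurable_sub_integrand (hH : ∀ p q, @Measurable (ℝ × Ω) ℝ
      (MeasurableSpace.prod inferInstance (F a)) inferInstance (fun z => H z.1 z.2 p q))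
    {G : Ω → Matrix (Fin n) (Fin d) ℝ} (hG : MatrixMeasurable (F a) G) (p : Fin n) (q : Fin d) :
    @Measurable (ℝ × Ω) ℝ (MeasurableSpace.prod inferInstance (F a)) inferInstance
      (fun z => (H z.1 z.2 - G z.2) p q) :=
  @Measurable.sub _ _ _ _ _ (_) _ _ (hH p q) ((hG p q).comp (@measurable_snd _ _ _ (F a)))

/-- The conditional mean-square error. -/
theorem condMSE_ae_eq [IsProbabilityMeasure P] (hab : a ≤ b)
    (hH : ∀ p q, @Measurable (ℝ × Ω) ℝ
      (MeasurableSpace.prod inferInstance (F a)) inferInstance (fun z => H z.1 z.2 p q))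
    (hw : IsBrownianMotionOn P F T w) (ha : 0 ≤ a) (hb : b ≤ T)
    (hV : ∀ᵐ ω ∂P, ∫⁻ s in Set.Ioc a b, ENNReal.ofReal (frobeniusSq (H s ω)) < ∞)
    (hI : IsItoIntegral P F w a b H (itoIntegral P F w a b H))
    {G : Ω → Matrix (Fin n) (Fin d) ℝ} (hG : MatrixMeasurable (F a) G) :
    condMSE P F w a b H G =ᵐ[P]
      fun ω => ∫⁻ s in Set.Ioc a b, ENNReal.ofReal (frobeniusSq (H s ω - G ω)) := by
  have hHG := measurable_sub_integrand hH hG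
  have hVG : ∀ᵐ ω ∂P,
      ∫⁻ s in Set.Ioc a b, ENNReal.ofReal (frobeniusSq (H s ω - G ω)) < ∞ := by
    filter_upwards [hV] with ω hω
    refine (lintegral_mono fun s => ofReal_frobeniusSq_sub_le (H s ω) (G ω)).trans_lt ?_
    rw [lintegral_add_right _ measurable_const, lintegral_const_mul' _ _ (by simp),
      lintegral_const]
    refine ENNReal.add_lt_top.2 ⟨ENNReal.mul_lt_top (by simp) hω, ENNReal.mul_lt_top
      (ENNReal.mul_lt_top (by simp) ENNReal.ofReal_lt_top) (by simp)⟩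
  obtain ⟨I, k, hk, hkI⟩ := exists_ae_tendsto_integral_averageProcess
    (H := fun s ω => H s ω - G ω) hab hHG hw ha hb hVG
  have hI2 := isItoIntegral_of_ae_tendsto (H := fun s ω => H s ω - G ω) hab hHG hw ha hb hVG hk hkI
  have hae := (hI.sub_const hab hG).ae_eq hw ha hb
    (fun ω p q => (measurable_section (H := fun s ω => H s ω - G ω) hHG ω p q).aemeasurable) hI2
  refine (condLExp_congr_ae ?_).trans (condLExp_sq_of_ae_tendsto
    (H := fun s ω => H s ω - G ω) hab hHG hw ha hb hVG hk hkI)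
  filter_upwards [hae] with ω hω
  rw [hω]

/-- The time average is the unique minimizer of the conditional mean-square error, for integrands
that are measurable on all of `ℝ × Ω`. -/
theorem uniquelyMinimizesCondMSE_timeAverage [IsProbabilityMeasure P] (hab : a < b)
    (hH : ∀ p q, @Measurable (ℝ × Ω) ℝ
      (MeasurableSpace.prod inferInstance (F a)) inferInstance (fun z => H z.1 z.2 p q))
    (hw : IsBrownianMotionOn P F T w) (ha : 0 ≤ a) (hb : b ≤ T)
    (hV : ∀ᵐ ω ∂P, ∫⁻ s in Set.Ioc a b, ENNReal.ofReal (frobeniusSq (H s ω)) < ∞) :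
    IsItoIntegral P F w a b H (itoIntegral P F w a b H) ∧
      UniquelyMinimizesCondMSE P F w a b H (timeAverage a b H) := by
  obtain ⟨I, k, hk, hkI⟩ := exists_ae_tendsto_integral_averageProcess hab.le hH hw ha hb hV
  have hI := isItoIntegral_itoIntegral
    (isItoIntegral_of_ae_tendsto hab.le hH hw ha hb hV hk hkI)
  have hK : MatrixMeasurable (F a) (timeAverage a b H) := fun p q => by
    simp only [timeAverage, Matrix.of_apply, intervalIntegral.integral_of_le hab.le]
    exact (@measurable_setIntegral_prod Ω (F a) _ (hH p q) _).const_mul _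
  have hdecomp := fun {ω : Ω} hω G => lintegral_frobeniusSq_sub hab (f := fun s => H s ω)
    (measurable_section hH ω) hω G (K := timeAverage a b H ω) fun p q => rfl
  have hmse := fun {G : Ω → Matrix (Fin n) (Fin d) ℝ} (hG : MatrixMeasurable (F a) G) =>
    condMSE_ae_eq hab.le hH hw ha hb hV hI hG
  have hKfin : ∀ {ω}, ∫⁻ s in Set.Ioc a b, ENNReal.ofReal (frobeniusSq (H s ω)) < ∞ →
      ∫⁻ s in Set.Ioc a b, ENNReal.ofReal (frobeniusSq (H s ω - timeAverage a b H ω)) < ∞ := by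
    intro ω hω
    have h := hdecomp hω 0
    simp only [sub_zero] at h
    exact (le_self_add.trans_eq h.symm).trans_lt hω
  have hpos : ∀ {ω} {G : Matrix (Fin n) (Fin d) ℝ}, G ≠ timeAverage a b H ω →
      0 < ENNReal.ofReal (frobeniusSq (G - timeAverage a b H ω)) * ENNReal.ofReal (b - a) :=
    fun h => ENNReal.mul_pos
      (ENNReal.ofReal_pos.2 (frobeniusSq_pos (sub_ne_zero.2 h))).ne'
      (ENNReal.ofReal_pos.2 (sub_pos.2 hab)).ne'
  refine ⟨hI, hK, ?_, fun G hG => ?_, fun ω G =>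
    (∫⁻ s in Set.Ioc a b, ENNReal.ofReal (frobeniusSq (H s ω - timeAverage a b H ω))) +
      ENNReal.ofReal (frobeniusSq (G - timeAverage a b H ω)) * ENNReal.ofReal (b - a),
    fun ω => ?_, fun G hG => ?_, ?_⟩
  · filter_upwards [hV, hmse hK] with ω hω h
    rw [h]
    exact hKfin hω
  · filter_upwards [hV, hmse hK, hmse hG] with ω hω h1 h2
    rw [h1, h2, hdecomp hω (G ω)]
    exact ⟨le_self_add, fun h => ENNReal.lt_add_right (hKfin hω).ne (hpos h).ne'⟩
  · refine continuous_const.add ((ENNReal.continuous_mul_const ENNReal.ofReal_ne_top).comp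
      (ENNReal.continuous_ofReal.comp ?_))
    unfold frobeniusSq
    simp only [Matrix.sub_apply]
    fun_prop
  · filter_upwards [hV, hmse hG] with ω hω h
    rw [h, hdecomp hω (G ω)]
  · filter_upwards [hV] with ω hω G hG
    simp only [sub_self, frobeniusSq_zero, ENNReal.ofReal_zero, zero_mul, add_zero]
    exact ENNReal.lt_add_right (hKfin hω).ne (hpos hG).ne'

theorem isItoIntegral_congr {H' : ℝ → Ω → Matrix (Fin n) (Fin d) ℝ}
    (h : ∀ s ∈ Set.Icc a b, ∀ ω, H s ω = H' s ω) :
    IsItoIntegral P F w a b H = IsItoIntegral P F w a b H' := by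
  have h1 : ∀ (S : StepProcess F n d a b) ω,
      ∫⁻ s in Set.Ioc a b, ENNReal.ofReal (frobeniusSq (S.value s ω - H s ω)) =
      ∫⁻ s in Set.Ioc a b, ENNReal.ofReal (frobeniusSq (S.value s ω - H' s ω)) :=
    fun S ω => setLIntegral_congr_fun measurableSet_Ioc fun s hs => by
      rw [h s (Set.Ioc_subset_Icc_self hs)]
  ext I
  simp only [IsItoIntegral, h1]

open Classical in
theorem itoIntegral_congr {H' : ℝ → Ω → Matrix (Fin n) (Fin d) ℝ}
    (h : ∀ s ∈ Set.Icc a b, ∀ ω, H s ω = H' s ω) :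
    itoIntegral P F w a b H = itoIntegral P F w a b H' := by
  have key : ∀ Q Q' : (Ω → EuclideanSpace ℝ (Fin n)) → Prop, Q = Q' →
      (if h : ∃ I, Q I then h.choose else 0) = if h : ∃ I, Q' I then h.choose else 0 := by
    rintro Q _ rfl
    rfl
  exact key _ _ (isItoIntegral_congr h)

theorem timeAverage_congr {H' : ℝ → Ω → Matrix (Fin n) (Fin d) ℝ} (hab : a ≤ b)
    (h : ∀ s ∈ Set.Icc a b, ∀ ω, H s ω = H' s ω) : timeAverage a b H = timeAverage a b H' := by
  ext ω p q
  simp only [timeAverage, Matrix.of_apply]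
  congr 1
  refine intervalIntegral.integral_congr fun s hs => ?_
  rw [h s (Set.uIcc_of_le hab ▸ hs)]

theorem condMSE_congr {H' : ℝ → Ω → Matrix (Fin n) (Fin d) ℝ}
    (h : ∀ s ∈ Set.Icc a b, ∀ ω, H s ω = H' s ω) :
    condMSE P F w a b H = condMSE P F w a b H' := by
  ext1 G
  unfold condMSE
  rw [itoIntegral_congr h]

theorem uniquelyMinimizesCondMSE_congr {H' : ℝ → Ω → Matrix (Fin n) (Fin d) ℝ}
    (h : ∀ s ∈ Set.Icc a b, ∀ ω, H s ω = H' s ω) {K : Ω → Matrix (Fin n) (Fin d) ℝ}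
    (hK : UniquelyMinimizesCondMSE P F w a b H' K) : UniquelyMinimizesCondMSE P F w a b H K := by
  have hc := condMSE_congr (P := P) (F := F) (w := w) h
  exact ⟨hK.measurable, hc ▸ hK.finite, hc ▸ hK.le_and_lt, hc ▸ hK.simultaneous⟩

theorem measurable_projIcc_prod {Ω : Type*} [MeasurableSpace Ω] {a b : ℝ} (hab : a ≤ b) :
    Measurable fun z : ℝ × Ω => (Set.projIcc a b hab z.1, z.2) :=
  (continuous_projIcc.measurable.comp measurable_fst).prodMk measurable_snd

/-- The time average is the unique minimizer of the conditional mean-square error. -/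
theorem isItoIntegral_and_uniquelyMinimizesCondMSE [IsProbabilityMeasure P] (hab : a < b)
    (hH : ∀ p q, @Measurable (Set.Icc a b × Ω) ℝ
      (MeasurableSpace.prod inferInstance (F a)) inferInstance (fun z => H z.1 z.2 p q))
    (hw : IsBrownianMotionOn P F T w) (ha : 0 ≤ a) (hb : b ≤ T)
    (hV : ∀ᵐ ω ∂P, ∫⁻ s in Set.Icc a b, ENNReal.ofReal (frobeniusSq (H s ω)) < ∞) :
    IsItoIntegral P F w a b H (itoIntegral P F w a b H) ∧
      UniquelyMinimizesCondMSE P F w a b H (timeAverage a b H) := by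
  let H' : ℝ → Ω → Matrix (Fin n) (Fin d) ℝ := fun s ω => H (Set.projIcc a b hab.le s) ω
  have hHH' : ∀ s ∈ Set.Icc a b, ∀ ω, H s ω = H' s ω := fun s hs ω => by
    simp only [H', Set.projIcc_of_mem hab.le hs]
  have hH' : ∀ p q, @Measurable (ℝ × Ω) ℝ (MeasurableSpace.prod inferInstance (F a))
      inferInstance (fun z => H' z.1 z.2 p q) := fun p q => by
    have h := @measurable_projIcc_prod Ω (F a) a b hab.le
    exact (hH p q).comp h
  have hV' : ∀ᵐ ω ∂P, ∫⁻ s in Set.Ioc a b, ENNReal.ofReal (frobeniusSq (H' s ω)) < ∞ := by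
    filter_upwards [hV] with ω hω
    refine (le_of_eq ?_).trans_lt ((lintegral_mono_set Set.Ioc_subset_Icc_self).trans_lt hω)
    refine setLIntegral_congr_fun measurableSet_Ioc fun s hs => ?_
    rw [hHH' s (Set.Ioc_subset_Icc_self hs)]
  obtain ⟨h1, h2⟩ := uniquelyMinimizesCondMSE_timeAverage hab hH' hw ha hb hV'
  rw [isItoIntegral_congr hHH', itoIntegral_congr hHH', timeAverage_congr hab.le hHH']
  exact ⟨h1, uniquelyMinimizesCondMSE_congr hHH' h2⟩

end orthogonalProjection

section stateTransition

variable {n : ℕ} {A : ℝ → Matrix (Fin n) (Fin n) ℝ} {Φ : ℝ → ℝ → Matrix (Fin n) (Fin n) ℝ}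
  {a b : ℝ}

theorem norm_mulVec_le {M : Matrix (Fin n) (Fin n) ℝ} {C : ℝ} (hM : ∀ p q, |M p q| ≤ C)
    (v : Fin n → ℝ) : ‖M.mulVec v‖ ≤ n * |C| * ‖v‖ := by
  refine (pi_norm_le_iff_of_nonneg (by positivity)).2 fun p => ?_
  calc ‖M.mulVec v p‖ ≤ ∑ q, ‖M p q * v q‖ := norm_sum_le Finset.univ fun q => M p q * v q
    _ ≤ ∑ _q : Fin n, |C| * ‖v‖ := by
      gcongr with q
      rw [norm_mul]
      gcongr
      · exact (hM p q).trans (le_abs_self C)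
      · exact norm_le_pi_norm v q
    _ = n * |C| * ‖v‖ := by simp [mul_assoc]

/-- A solution of a linear equation with bounded coefficients that vanishes at one time vanishes
at the left endpoint and at all later times. -/
theorem linear_ode_eq_zero (hA : BoundedOn A a b) {f : ℝ → Fin n → ℝ}
    (hf : ContinuousOn f (Set.Icc a b))
    (hf' : ∀ τ ∈ Set.Ico a b, HasDerivWithinAt f ((A τ).mulVec (f τ)) (Set.Icc a b) τ) {s : ℝ}
    (hs : s ∈ Set.Ico a b) (hfs : f s = 0) : f a = 0 ∧ f b = 0 := by
  obtain ⟨C, hC⟩ := hA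
  constructor
  · have h := eq_zero_of_abs_deriv_le_mul_abs_self_of_eq_zero_right (f := fun r => f (-r))
      (f' := fun r => -(A (-r)).mulVec (f (-r))) (K := n * |C|) (a := -s) (b := -a)
      (hf.comp continuousOn_neg fun r hr => ⟨by linarith [hr.2], by linarith [hr.1, hs.2]⟩)
      (fun r hr => ?_) (by simpa using hfs) (fun r hr => ?_) (-a) ⟨by linarith [hs.1], le_rfl⟩
    · simpa using h
    · have hr' : -r ∈ Set.Ioo a b := ⟨by linarith [hr.2], by linarith [hr.1, hs.2]⟩
      have h1 := (hf' (-r) (Set.Ioo_subset_Ico_self hr')).hasDerivAt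
        (Icc_mem_nhds hr'.1 hr'.2)
      have h2 := h1.scomp r (hasDerivAt_neg r)
      rw [neg_one_smul] at h2
      exact h2.hasDerivWithinAt
    · rw [norm_neg]
      exact norm_mulVec_le (hC (-r) ⟨by linarith [hr.2], by linarith [hr.1, hs.2]⟩) _
  · refine eq_zero_of_abs_deriv_le_mul_abs_self_of_eq_zero_right (f := f)
      (f' := fun r => (A r).mulVec (f r)) (K := n * |C|) (a := s) (b := b)
      (hf.mono (Set.Icc_subset_Icc_left hs.1)) (fun r hr => ?_) hfs (fun r hr => ?_) b
      ⟨hs.2.le, le_rfl⟩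
    · have hr' : r ∈ Set.Ico a b := ⟨hs.1.trans hr.1, hr.2⟩
      exact (hf' r hr').mono_of_mem_nhdsWithin (Icc_mem_nhdsGE_of_mem hr')
    · exact norm_mulVec_le (hC r ⟨hs.1.trans hr.1, hr.2.le⟩) _

namespace IsStateTransitionOn

theorem continuousOn_col (hΦ : IsStateTransitionOn A a b Φ) {s : ℝ} (hs : s ∈ Set.Icc a b)
    (q : Fin n) : ContinuousOn (fun r p => Φ r s p q) (Set.Icc a b) :=
  continuousOn_pi.2 fun p => hΦ.cont s hs p q

theorem hasDerivWithinAt_col (hΦ : IsStateTransitionOn A a b Φ) {s : ℝ} (hs : s ∈ Set.Icc a b)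
    (q : Fin n) {τ : ℝ} (hτ : τ ∈ Set.Ico a b) :
    HasDerivWithinAt (fun r p => Φ r s p q) ((A τ).mulVec fun p => Φ τ s p q) (Set.Icc a b) τ :=
  hasDerivWithinAt_pi.2 fun p => hΦ.deriv s hs τ hτ p q

theorem abs_le (hΦ : IsStateTransitionOn A a b Φ) (hA : BoundedOn A a b) :
    ∃ C : ℝ, ∀ s ∈ Set.Icc a b, ∀ p q, |Φ b s p q| ≤ C := by
  obtain ⟨C, hC⟩ := hA
  refine ⟨Real.exp (n * |C| * (b - a)), fun s hs p q => ?_⟩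
  have h := norm_le_gronwallBound_of_norm_deriv_right_le (f := fun r p => Φ r s p q)
    (f' := fun r => (A r).mulVec fun p => Φ r s p q) (δ := 1) (K := n * |C|) (ε := 0) (a := s)
    (b := b) ((hΦ.continuousOn_col hs q).mono (Set.Icc_subset_Icc_left hs.1)) (fun r hr => ?_) ?_
    (fun r hr => ?_) b ⟨hs.2, le_rfl⟩
  · rw [gronwallBound_ε0, one_mul] at h
    refine ((norm_le_pi_norm (fun p => Φ b s p q) p).trans h).trans ?_
    gcongr
    exact hs.1
  · have hr' : r ∈ Set.Ico a b := ⟨hs.1.trans hr.1, hr.2⟩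
    exact (hΦ.hasDerivWithinAt_col hs q hr').mono_of_mem_nhdsWithin (Icc_mem_nhdsGE_of_mem hr')
  · refine (pi_norm_le_iff_of_nonneg zero_le_one).2 fun p => ?_
    rw [hΦ.self s hs, Matrix.one_apply]
    split_ifs <;> simp
  · rw [add_zero]
    exact norm_mulVec_le (hC r ⟨hs.1.trans hr.1, hr.2.le⟩) _

theorem mul_eq (hΦ : IsStateTransitionOn A a b Φ) (hA : BoundedOn A a b) {s : ℝ}
    (hs : s ∈ Set.Ico a b) : Φ a s * Φ s a = 1 ∧ Φ b s * Φ s a = Φ b a := by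
  have hs' := Set.Ico_subset_Icc_self hs
  have ha : a ∈ Set.Icc a b := ⟨le_rfl, hs.1.trans hs.2.le⟩
  have key : ∀ q, (fun p => (Φ a s * Φ s a - Φ a a) p q) = 0 ∧
      (fun p => (Φ b s * Φ s a - Φ b a) p q) = 0 := by
    intro q
    refine linear_ode_eq_zero hA (f := fun r p => (Φ r s * Φ s a - Φ r a) p q)
      (continuousOn_pi.2 fun p => ?_) (fun τ hτ => hasDerivWithinAt_pi.2 fun p => ?_) hs ?_
    · simp only [Matrix.sub_apply, Matrix.mul_apply]
      exact (continuousOn_finsetSum _ fun j _ => (hΦ.cont s hs' p j).mul continuousOn_const).sub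
        (hΦ.cont a ha p q)
    · have h1 : HasDerivWithinAt (fun r => ∑ j, Φ r s p j * Φ s a j q - Φ r a p q)
          (∑ j, (A τ * Φ τ s) p j * Φ s a j q - (A τ * Φ τ a) p q) (Set.Icc a b) τ :=
        (HasDerivWithinAt.fun_sum fun j _ => (hΦ.deriv s hs' τ hτ p j).mul_const _).sub
          (hΦ.deriv a ha τ hτ p q)
      have h2 : ((A τ).mulVec fun p => (Φ τ s * Φ s a - Φ τ a) p q) p =
          ∑ j, (A τ * Φ τ s) p j * Φ s a j q - (A τ * Φ τ a) p q := by
        have h3 : ((A τ).mulVec fun p => (Φ τ s * Φ s a - Φ τ a) p q) p =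
            (A τ * (Φ τ s * Φ s a - Φ τ a)) p q := rfl
        rw [h3, Matrix.mul_sub, ← Matrix.mul_assoc, Matrix.sub_apply, Matrix.mul_apply]
      rw [h2]
      exact h1
    · ext p
      simp [hΦ.self s hs']
  constructor
  · rw [← hΦ.self a ha, ← sub_eq_zero]
    ext p q
    exact congrFun (key q).1 p
  · rw [← sub_eq_zero]
    ext p q
    exact congrFun (key q).2 p

theorem measurable_right (hΦ : IsStateTransitionOn A a b Φ) (hA : BoundedOn A a b) (hab : a ≤ b)
    (p q : Fin n) : Measurable fun s : Set.Icc a b => Φ b s p q := by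
  have hc : Continuous fun s : Set.Icc a b => Φ s a :=
    continuous_matrix fun p q => (hΦ.cont a ⟨le_rfl, hab⟩ p q).domRestrict
  have h : (fun s : Set.Icc a b => Φ b s p q) = fun s : Set.Icc a b =>
      if (s : ℝ) = b then (1 : Matrix (Fin n) (Fin n) ℝ) p q
      else ∑ j, Φ b a p j * ((Φ s a).det⁻¹ * (Φ s a).adjugate j q) := by
    ext s
    split_ifs with hs
    · rw [hs, hΦ.self b ⟨hab, le_rfl⟩]
    · obtain ⟨h1, h2⟩ := hΦ.mul_eq hA ⟨s.2.1, lt_of_le_of_ne s.2.2 hs⟩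
      have h3 : Φ b s = Φ b a * (Φ s a)⁻¹ := by
        rw [Matrix.inv_eq_left_inv h1, ← h2, Matrix.mul_assoc, mul_eq_one_comm.1 h1,
          Matrix.mul_one]
      rw [h3, Matrix.inv_def, Ring.inverse_eq_inv', Matrix.mul_apply]
      rfl
  rw [h]
  refine Measurable.ite (measurable_subtype_coe (measurableSet_singleton b)) measurable_const ?_
  exact Finset.measurable_sum _ fun j _ => measurable_const.mul
    (hc.matrix_det.measurable.inv.mul (hc.matrix_adjugate.matrix_elem j q).measurable)

end IsStateTransitionOn

end stateTransition

section frozenIntegrand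

variable {n m d : ℕ} {a b : ℝ} {A : ℝ → Matrix (Fin n) (Fin n) ℝ}
  {Φ : ℝ → ℝ → Matrix (Fin n) (Fin n) ℝ} {At : Fin d → ℝ → Matrix (Fin n) (Fin n) ℝ}
  {Ft : Fin d → ℝ → Matrix (Fin n) (Fin (m + 1)) ℝ} {dt : Fin d → ℝ → Fin n → ℝ}

theorem measurable_frozenIntegrand {Ω : Type*} [MeasurableSpace Ω] {x : Ω → Fin n → ℝ}
    {u : Ω → Fin (m + 1) → ℝ} (hΦ : ∀ p q, Measurable fun s : Set.Icc a b => Φ b s p q)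
    (hAt : ∀ i p q, Measurable fun τ => At i τ p q) (hFt : ∀ i p q, Measurable fun τ => Ft i τ p q)
    (hdt : ∀ i, Measurable (dt i)) (hx : Measurable x) (hu : Measurable u) (p : Fin n)
    (i : Fin d) : Measurable fun z : Set.Icc a b × Ω =>
      frozenIntegrand Φ At Ft dt b x u z.1 z.2 p i := by
  have h1 : Measurable fun z : Set.Icc a b × Ω => (z.1 : ℝ) :=
    measurable_subtype_coe.comp measurable_fst
  simp only [frozenIntegrand, Matrix.of_apply, Matrix.mulVec, dotProduct, Pi.add_apply]
  refine Finset.measurable_sum _ fun j _ => ((hΦ p j).comp measurable_fst).mul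
    (((Finset.measurable_sum _ fun l _ => ?_).add (Finset.measurable_sum _ fun l _ => ?_)).add
      ((measurable_pi_apply j).comp ((hdt i).comp h1)))
  · exact ((hAt i j l).comp h1).mul ((measurable_pi_apply l).comp (hx.comp measurable_snd))
  · exact ((hFt i j l).comp h1).mul ((measurable_pi_apply l).comp (hu.comp measurable_snd))

open Asymptotics in
theorem lintegral_frozenIntegrand_lt_top {Ω : Type*} (x : Ω → Fin n → ℝ)
    (u : Ω → Fin (m + 1) → ℝ) (hΦ : ∃ C : ℝ, ∀ s ∈ Set.Icc a b, ∀ p q, |Φ b s p q| ≤ C)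
    (hAt : ∀ i, BoundedOn (At i) a b) (hFt : ∀ i, BoundedOn (Ft i) a b)
    (hdt : ∀ i, ∃ C : ℝ, ∀ τ ∈ Set.Icc a b, ∀ p, |dt i τ p| ≤ C) (ω : Ω) :
    ∫⁻ τ in Set.Icc a b,
      ENNReal.ofReal (frobeniusSq (frozenIntegrand Φ At Ft dt b x u τ ω)) < ∞ := by
  let one : ℝ → ℝ := fun _ => 1
  have hmul : ∀ {f g : ℝ → ℝ}, f =O[𝓟 (Set.Icc a b)] one → g =O[𝓟 (Set.Icc a b)] one →
      (fun τ => f τ * g τ) =O[𝓟 (Set.Icc a b)] one := fun hf hg => by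
    simpa [one] using hf.mul hg
  have hbd : ∀ {f : ℝ → ℝ} {C : ℝ}, (∀ τ ∈ Set.Icc a b, |f τ| ≤ C) →
      f =O[𝓟 (Set.Icc a b)] one := fun {f C} h =>
    isBigO_principal.2 ⟨C, fun τ hτ => by simpa [one] using h τ hτ⟩
  have hconst : ∀ c : ℝ, (fun _ : ℝ => c) =O[𝓟 (Set.Icc a b)] one := fun c =>
    hbd fun _ _ => le_rfl
  have hentry : ∀ p i, (fun τ => frozenIntegrand Φ At Ft dt b x u τ ω p i)
      =O[𝓟 (Set.Icc a b)] one := by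
    intro p i
    obtain ⟨C₀, h₀⟩ := hΦ
    obtain ⟨C₁, h₁⟩ := hAt i
    obtain ⟨C₂, h₂⟩ := hFt i
    obtain ⟨C₃, h₃⟩ := hdt i
    simp only [frozenIntegrand, Matrix.of_apply, Matrix.mulVec, dotProduct, Pi.add_apply]
    refine IsBigO.fun_sum fun j _ => hmul (hbd fun τ hτ => h₀ τ hτ p j)
      (((IsBigO.fun_sum fun l _ => hmul (hbd fun τ hτ => h₁ τ hτ j l) (hconst _)).add
        (IsBigO.fun_sum fun l _ => hmul (hbd fun τ hτ => h₂ τ hτ j l) (hconst _))).add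
        (hbd fun τ hτ => h₃ τ hτ j))
  have hfrob : (fun τ => frobeniusSq (frozenIntegrand Φ At Ft dt b x u τ ω))
      =O[𝓟 (Set.Icc a b)] one := by
    unfold frobeniusSq
    simp only [sq]
    exact IsBigO.fun_sum fun p _ => IsBigO.fun_sum fun i _ => hmul (hentry p i) (hentry p i)
  obtain ⟨C, hC⟩ := isBigO_principal.1 hfrob
  refine (setLIntegral_mono' (g := fun _ => ENNReal.ofReal C) measurableSet_Icc
    fun τ hτ => ENNReal.ofReal_le_ofReal ?_).trans_lt ?_
  · simpa [one] using (le_abs_self _).trans (hC τ hτ)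
  · rw [setLIntegral_const]
    exact ENNReal.mul_lt_top ENNReal.ofReal_lt_top (by simp)

end frozenIntegrand

theorem mainTheorem4 {Ω : Type*} {mΩ : MeasurableSpace Ω} (P : Measure Ω) [IsProbabilityMeasure P]
    (F : Filtration ℝ mΩ) {n m d : ℕ} (w : ℝ → Ω → EuclideanSpace ℝ (Fin d))
    (hw : IsBrownianMotionOn P F 1 w)
    {N : ℕ} (t : Fin (N + 1) → ℝ) (ht : StrictMono t) (ht0 : t 0 = 0) (ht1 : t (Fin.last N) = 1)
    (k : Fin N) (a b : ℝ) (ha : a = t k.castSucc) (hb : b = t k.succ) :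
    -- every `F a`-measurable integrand whose paths on `[a, b]` are square-integrable
    (∀ H : ℝ → Ω → Matrix (Fin n) (Fin d) ℝ,
      (∀ p q, @Measurable (Set.Icc a b × Ω) ℝ (MeasurableSpace.prod inferInstance (F a))
        inferInstance (fun z => H z.1 z.2 p q)) →
      (∀ᵐ ω ∂P, ∫⁻ τ in Set.Icc a b, ENNReal.ofReal (frobeniusSq (H τ ω)) < ∞) →
      IsItoIntegral P F w a b H (itoIntegral P F w a b H) ∧
      UniquelyMinimizesCondMSE P F w a b H (timeAverage a b H)) ∧
    -- in particular the integrand with frozen state and control of the linearized dynamics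
    (∀ (A : ℝ → Matrix (Fin n) (Fin n) ℝ) (Φ : ℝ → ℝ → Matrix (Fin n) (Fin n) ℝ)
      (At : Fin d → ℝ → Matrix (Fin n) (Fin n) ℝ)
      (Ft : Fin d → ℝ → Matrix (Fin n) (Fin (m + 1)) ℝ) (dt : Fin d → ℝ → Fin n → ℝ)
      (x : Ω → Fin n → ℝ) (u : Ω → Fin (m + 1) → ℝ),
      BoundedOn A a b → IsStateTransitionOn A a b Φ →
      (∀ i p q, Measurable fun τ => At i τ p q) → (∀ i, BoundedOn (At i) a b) →
      (∀ i p q, Measurable fun τ => Ft i τ p q) → (∀ i, BoundedOn (Ft i) a b) →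
      (∀ i, Measurable (dt i)) → (∀ i, ∃ C : ℝ, ∀ τ ∈ Set.Icc a b, ∀ p, |dt i τ p| ≤ C) →
      Measurable[F a] x → Measurable[F a] u →
      IsItoIntegral P F w a b (frozenIntegrand Φ At Ft dt b x u)
        (itoIntegral P F w a b (frozenIntegrand Φ At Ft dt b x u)) ∧
      UniquelyMinimizesCondMSE P F w a b (frozenIntegrand Φ At Ft dt b x u)
        (timeAverage a b (frozenIntegrand Φ At Ft dt b x u))) := by
  have hab : a < b := ha ▸ hb ▸ ht (Fin.castSucc_lt_succ)
  have ha0 : 0 ≤ a := ha ▸ ht0 ▸ ht.monotone (Fin.zero_le _)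
  have hb1 : b ≤ 1 := hb ▸ ht1 ▸ ht.monotone (Fin.le_last _)
  refine ⟨fun H hH hV => isItoIntegral_and_uniquelyMinimizesCondMSE hab hH hw ha0 hb1 hV, ?_⟩
  intro A Φ At Ft dt x u hA hΦ hAt hAt' hFt hFt' hdt hdt' hx hu
  refine isItoIntegral_and_uniquelyMinimizesCondMSE hab (fun p q => ?_) hw ha0 hb1
    (ae_of_all _ fun ω => ?_)
  · exact @measurable_frozenIntegrand n m d a b Φ At Ft dt Ω (F a) x u
      (hΦ.measurable_right hA hab.le) hAt hFt hdt hx hu p q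
  · exact lintegral_frozenIntegrand_lt_top x u (hΦ.abs_le hA) hAt' hFt' hdt' ω
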